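/- Let $n\ge 1$. For a cube $S\subset\mathbb R^n$ (closed, with sides parallel to the axes) of sidelength $\ell(S)$ and for a real $\mu\ge 1$, let $$\psi^{\mu}_S(x)=\begin{cases}\left(1-\frac1\mu\log_2\frac{\ell(S)}{4\,d(x,\partial S)}\right)_+ & \text{if } d(x,\partial S)<\ell(S)/4,\\ 1 & \text{otherwise,}\end{cases}\qquad x\in S,$$ be the Brezis–Nirenberg bump function of $S$ (equal to $0$ on $\partial S$). A modulus of continuity is a bounded nondecreasing function $\eta:[0,\infty)\to[0,\infty)$ that is continuous at $0$ with $\eta(0)=0$; $\|\eta\|_\infty$ is its supremum. Two different cubes of a family are adjacent if they intersect. Let $(S_i)$ be a countable family of dyadic cubes in $\mathbb R^n$ with pairwise disjoint interiors and $L:=\sup_i\ell(S_i)<\infty$, and put $\mathcal O=\left(\bigcup_i S_i\right)^{\circ}$. Suppose that the cubes are of Whitney type, that is, $$\tfrac14\,\ell(S_i)\le\ell(S_j)\le 4\,\ell(S_i)\ \text{ for adjacent } S_i,S_j,\qquad \operatorname{dist}(S_i,\mathbb R^n\setminus\mathcal O)\le 4\sqrt n\,\ell(S_i)\ \text{ for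 all } i$$ (where the distance to the empty set is $\infty$). Let $\lambda_i\in\mathbb R$ and $\mu_i\ge 1$ be real numbers, and suppose that there are constants $C_1>0$, $C_2\in\mathbb R$, $C_3>0$ and moduli of continuity $\delta_1,\delta_2$ such that 1. $\mu_i\ge C_1\log_2\frac{L}{\ell(S_i)}-C_2$ for all $i$; 2. $|\mu_i-\mu_j|\le C_3$ for all adjacent $S_i,S_j$; 3. $\frac{|\lambda_i|}{\mu_i}\le\delta_1\left(\frac1{\mu_i}\right)$ for all $i$; 4. $|\lambda_i-\lambda_j|\le\delta_2\left(\frac1{\mu_i}+\frac1{\mu_j}\right)$ for all adjacent $S_i,S_j$. Define $\Psi$ on $\bigcup_i S_i$ by $\Psi(x)=\lambda_i\psi^{\mu_i}_{S_i}(x)$ for $x\in S_i$. Then $\Psi\in\mathrm{VMO}(\mathcal O)$, that is, $\Psi$ is locally integrable on $\mathcal O$, $$\|\Psi\|_{\mathrm{BMO}(\mathcal O)}:=\sup_{\text{cubes }Q\subset\mathcal O}\frac1{|Q|}\int_Q|\Psi-\Psi_Q|<\infty\quad\text{and}\quad \lim_{t\to0^+}\ \sup_{\text{cubes }Q\subset\mathcal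 O,\ \ell(Q)<t}\frac1{|Q|}\int_Q|\Psi-\Psi_Q|=0,$$ where $\Psi_Q$ is the average of $\Psi$ on $Q$. Moreover $$\|\Psi\|_{\mathrm{BMO}(\mathcal O)}\le C\left(\|\delta_1\|_\infty+\|\delta_2\|_\infty\right),$$ where $C$ depends only on $n$, $C_1$, $C_2$ and $C_3$. -/

import Mathlib

open Set Filter Topology MeasureTheory
open scoped ENNReal

noncomputable section

/-! Cubes in `ℝⁿ` have sides parallel to the axes and are closed. -/

/-- The closed cube with lower corner `a` and sidelength `ℓ`. -/
def cube {n : ℕ} (a : EuclideanSpace ℝ (Fin n)) (ℓ : ℝ) : Set (EuclideanSpace ℝ (Fin n)) :=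
  {x | ∀ k, a k ≤ x k ∧ x k ≤ a k + ℓ}

/-- The dyadic cube `∏ₖ [mₖ 2ʲ, (mₖ + 1) 2ʲ]`, with `j = scale` and `m = index`. -/
structure DyadicCube (n : ℕ) where
  scale : ℤ
  index : Fin n → ℤ

namespace DyadicCube

variable {n : ℕ}

/-- The sidelength. -/
def side (S : DyadicCube n) : ℝ := (2 : ℝ) ^ S.scale

/-- The lower corner. -/
def corner (S : DyadicCube n) : EuclideanSpace ℝ (Fin n) :=
  WithLp.toLp 2 fun k => (S.index k : ℝ) * S.side

/-- The cube as a set of points. -/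
def carrier (S : DyadicCube n) : Set (EuclideanSpace ℝ (Fin n)) := cube S.corner S.side

/-- Two members `i`, `j` of a family of cubes are adjacent if they are different members
and the closed cubes intersect. -/
def Adjacent {ι : Type*} (S : ι → DyadicCube n) (i j : ι) : Prop :=
  i ≠ j ∧ ((S i).carrier ∩ (S j).carrier).Nonempty

/-- The interior of the union of a family of closed cubes. -/
def unionInterior {ι : Type*} (S : ι → DyadicCube n) : Set (EuclideanSpace ℝ (Fin n)) :=
  interior (⋃ i, (S i).carrier)

open Classical in
/-- The Brezis-Nirenberg logarithmic bump function of the cube `S` with exponent `μ`. With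
`d = d(x, ∂S)`, its value at `x ∈ S` is `1` if `d ≥ ℓ(S)/4` and
`(1 - μ⁻¹ log₂ (ℓ(S) / (4 d)))₊` if `d < ℓ(S)/4`; for `d = 0` this reads `(1 - ∞)₊ = 0`. -/
def bump (S : DyadicCube n) (μ : ℝ) (x : EuclideanSpace ℝ (Fin n)) : ℝ :=
  let d := Metric.infDist x (frontier S.carrier)
  if S.side / 4 ≤ d then 1
  else if d = 0 then 0
  else max 0 (1 - 1 / μ * Real.logb 2 (S.side / (4 * d)))

end DyadicCube

/-- A modulus of continuity: a bounded nondecreasing function `[0,∞) → [0,∞)` that vanishes at `0`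
and is continuous at `0`. Only the values on `[0,∞)` matter. -/
structure IsModulus (η : ℝ → ℝ) : Prop where
  nonneg : ∀ t, 0 ≤ t → 0 ≤ η t
  mono : MonotoneOn η (Ici 0)
  bdd : BddAbove (η '' Ici 0)
  zero : η 0 = 0
  cont : ContinuousWithinAt η (Ici 0) 0

/-- The supremum norm of a modulus of continuity. -/
def modulusSup (η : ℝ → ℝ) : ℝ := sSup (η '' Ici 0)

section Oscillation

variable {n : ℕ}

/-- The mean oscillation of `f` on `Q`. -/
def meanOsc (f : EuclideanSpace ℝ (Fin n) → ℝ) (Q : Set (EuclideanSpace ℝ (Fin n))) : ℝ :=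
  ⨍ x in Q, |f x - ⨍ y in Q, f y|

/-- The `BMO` norm: the supremum of the mean oscillations over all cubes contained in `O`. -/
def bmoNorm (O : Set (EuclideanSpace ℝ (Fin n))) (f : EuclideanSpace ℝ (Fin n) → ℝ) : ℝ≥0∞ :=
  ⨆ (a : EuclideanSpace ℝ (Fin n)) (ℓ : ℝ) (_ : 0 < ℓ) (_ : cube a ℓ ⊆ O),
    ENNReal.ofReal (meanOsc f (cube a ℓ))

/-- The modulus of mean oscillation `ω_O(f, t)`: the supremum of the mean oscillations over all
cubes contained in `O` of sidelength less than `t`. -/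
def oscModulus (O : Set (EuclideanSpace ℝ (Fin n))) (f : EuclideanSpace ℝ (Fin n) → ℝ)
    (t : ℝ) : ℝ≥0∞ :=
  ⨆ (a : EuclideanSpace ℝ (Fin n)) (ℓ : ℝ) (_ : 0 < ℓ) (_ : ℓ < t) (_ : cube a ℓ ⊆ O),
    ENNReal.ofReal (meanOsc f (cube a ℓ))

/-- Functions of bounded mean oscillation on the open set `O`. -/
def MemBMO (O : Set (EuclideanSpace ℝ (Fin n))) (f : EuclideanSpace ℝ (Fin n) → ℝ) : Prop :=
  LocallyIntegrableOn f O volume ∧ bmoNorm O f < ∞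

/-- Functions of vanishing mean oscillation on the open set `O`. -/
def MemVMO (O : Set (EuclideanSpace ℝ (Fin n))) (f : EuclideanSpace ℝ (Fin n) → ℝ) : Prop :=
  MemBMO O f ∧ Tendsto (oscModulus O f) (𝓝[>] 0) (𝓝 0)

end Oscillation

end

/-! Let Q be a cube of sidelength r contained in the open set. As a function of the distance d to
the boundary, a bump is affine in the logarithm of d, truncated, with slope 1/μ. So if d ≤ 2r on Q
within each cube, the function on S_i is compared with its height V_i = λ_i ψ_i(r) at depth r. The
deviation is at most |λ_i|/μ_i times one plus the number of dyadic layers around the boundary that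
contain the point (`ofReal_abs_bumpProfile_sub_le`). Layer volumes decay geometrically, so the
deviation integrates to O(|λ_i|/μ_i · min(ℓ_i, r)^n). Heights on adjacent cubes differ by O(|λ_i -
λ_j| + |λ_i|/μ_i), by `abs_mul_bumpProfile_sub_le`.

To compare V_i with the height at the centre of Q, follow the segment from x to the centre. The
total change is at most the largest jump times the number of cubes met
(`ofReal_abs_sub_le_tsum_of_isPreconnected`). If the segment meets S_j, the Whitney condition puts a
point outside Q within O(ℓ_j) of the meeting point. Since the segment runs towards the centre, x
itself lies within O(min(ℓ_j, r)) of S_j (`abs_sub_le_of_mem_segment_center`). Integrating over x,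
each S_j again costs O(min(ℓ_j, r)^n), and these volumes sum to at most (3r)^n by
`tsum_min_side_pow_le`. This is `meanOsc_le_of_glued`. If some point of Q has d > 2r, then Q lies in
a single cube and the bump is estimated directly.

Global bounds on the moduli give BMO. For VMO, large exponents make the moduli small. Bounded
exponents force the sidelengths to be bounded below, so that the bump vanishes in a boundary strip
of fixed width and is Lipschitz; small cubes Q then see almost no oscillation. -/

/-! ### Geometry and volumes of cubes and boundary layers -/

section CubeGeometry

variable {n : ℕ}

/-- The open box with lower corner `a` and upper corner `b`. -/
def openBox (a b : Fin n → ℝ) : Set (EuclideanSpace ℝ (Fin n)) :=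
  {x | ∀ k, a k < x k ∧ x k < b k}

/-- The closed box with lower corner `a` and upper corner `b`. -/
def closedBox (a b : Fin n → ℝ) : Set (EuclideanSpace ℝ (Fin n)) :=
  {x | ∀ k, a k ≤ x k ∧ x k ≤ b k}

theorem openBox_eq_preimage (a b : Fin n → ℝ) :
    openBox a b = WithLp.ofLp ⁻¹' (Set.pi univ fun k => Ioo (a k) (b k)) := by
  ext x; simp [openBox, Set.mem_pi]

theorem closedBox_eq_preimage (a b : Fin n → ℝ) :
    closedBox a b = WithLp.ofLp ⁻¹' (Icc a b) := by
  ext x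
  simp [closedBox, Pi.le_def, forall_and]

theorem cube_eq_closedBox (a : EuclideanSpace ℝ (Fin n)) (ℓ : ℝ) :
    cube a ℓ = closedBox (fun k => a k) (fun k => a k + ℓ) := rfl

theorem measurableSet_openBox (a b : Fin n → ℝ) : MeasurableSet (openBox a b) := by
  rw [openBox_eq_preimage]
  exact (PiLp.volume_preserving_ofLp (Fin n)).measurable
    (MeasurableSet.univ_pi fun k => measurableSet_Ioo)

theorem volume_openBox (a b : Fin n → ℝ) :
    volume (openBox a b) = ∏ k, ENNReal.ofReal (b k - a k) := by
  rw [openBox_eq_preimage, (PiLp.volume_preserving_ofLp (Fin n)).measure_preimage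
    (MeasurableSet.univ_pi fun k => measurableSet_Ioo).nullMeasurableSet, Real.volume_pi_Ioo]

theorem volume_closedBox (a b : Fin n → ℝ) :
    volume (closedBox a b) = ∏ k, ENNReal.ofReal (b k - a k) := by
  rw [closedBox_eq_preimage, (PiLp.volume_preserving_ofLp (Fin n)).measure_preimage
    measurableSet_Icc.nullMeasurableSet, Real.volume_Icc_pi]

theorem volume_cube (a : EuclideanSpace ℝ (Fin n)) (ℓ : ℝ) :
    volume (cube a ℓ) = ENNReal.ofReal ℓ ^ n := by
  rw [cube_eq_closedBox, volume_closedBox]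
  simp

theorem isCompact_cube (a : EuclideanSpace ℝ (Fin n)) (ℓ : ℝ) : IsCompact (cube a ℓ) := by
  rw [cube_eq_closedBox, closedBox_eq_preimage]
  exact (PiLp.homeomorph 2 (fun _ : Fin n => ℝ)).isCompact_preimage.2 isCompact_Icc

theorem convex_cube (a : EuclideanSpace ℝ (Fin n)) (ℓ : ℝ) : Convex ℝ (cube a ℓ) := by
  intro x hx y hy s t hs ht hst k
  have h1 := hx k
  have h2 := hy k
  simp only [PiLp.add_apply, PiLp.smul_apply, smul_eq_mul]
  have : t = 1 - s := by linarith
  subst this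
  constructor <;> nlinarith

theorem interior_cube (a : EuclideanSpace ℝ (Fin n)) (ℓ : ℝ) :
    interior (cube a ℓ) = openBox (fun k => a k) (fun k => a k + ℓ) := by
  have : cube a ℓ = (PiLp.homeomorph 2 (fun _ : Fin n => ℝ)) ⁻¹'
      (Set.pi univ fun k => Icc (a k) (a k + ℓ)) := by
    ext x
    simp only [mem_preimage, Set.mem_univ_pi]
    rfl
  rw [this, ← Homeomorph.preimage_interior, interior_pi_set finite_univ, openBox_eq_preimage]
  simp only [interior_Icc]
  rfl

theorem mem_frontier_cube {a x : EuclideanSpace ℝ (Fin n)} {ℓ : ℝ} :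
    x ∈ frontier (cube a ℓ) ↔ x ∈ cube a ℓ ∧ ∃ k, x k = a k ∨ x k = a k + ℓ := by
  rw [frontier, (isCompact_cube a ℓ).isClosed.closure_eq, interior_cube, Set.mem_sdiff]
  refine and_congr_right fun hx => ?_
  simp only [openBox, mem_ofPred_eq, not_forall]
  refine exists_congr fun k => ?_
  have := hx k
  constructor
  · intro h
    by_contra! hne
    exact h ⟨lt_of_le_of_ne this.1 (Ne.symm hne.1), lt_of_le_of_ne this.2 hne.2⟩
  · rintro (h | h) ⟨h1, h2⟩ <;> linarith

/-- The distance from a point of a cube to the boundary is read off from the coordinates. -/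
theorem le_infDist_frontier_cube [NeZero n] {a x : EuclideanSpace ℝ (Fin n)} {ℓ : ℝ}
    (hx : x ∈ cube a ℓ) {s : ℝ} :
    s ≤ Metric.infDist x (frontier (cube a ℓ)) ↔ ∀ k, s ≤ x k - a k ∧ s ≤ a k + ℓ - x k := by
  -- Moving one coordinate onto a face gives a boundary point at exactly the coordinate distance.
  have key : ∀ (k : Fin n) (c : ℝ), (c = a k ∨ c = a k + ℓ) →
      WithLp.toLp 2 (Function.update (fun j => x j) k c) ∈ frontier (cube a ℓ) ∧
      dist x (WithLp.toLp 2 (Function.update (fun j => x j) k c)) = |x k - c| := by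
    intro k c hc
    constructor
    · rw [mem_frontier_cube]
      refine ⟨fun j => ?_, k, by simpa using hc⟩
      rcases eq_or_ne j k with rfl | hj
      · have := hx j
        simp only [Function.update_self]
        rcases hc with rfl | rfl
        · exact ⟨le_rfl, by linarith⟩
        · exact ⟨by linarith, le_rfl⟩
      · simpa [hj] using hx j
    · rw [EuclideanSpace.dist_eq, Finset.sum_eq_single k]
      · simp [Real.dist_eq, Real.sqrt_sq_eq_abs]
      · intro j _ hj
        simp [hj]
      · simp
  have hne : (frontier (cube a ℓ)).Nonempty := ⟨_, (key 0 _ (Or.inl rfl)).1⟩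
  rw [Metric.le_infDist hne]
  constructor
  · intro h k
    have h1 := h (key k _ (Or.inl rfl)).1
    have h2 := h (key k _ (Or.inr rfl)).1
    rw [(key k _ (Or.inl rfl)).2, abs_of_nonneg (by linarith [(hx k).1])] at h1
    rw [(key k _ (Or.inr rfl)).2, abs_sub_comm, abs_of_nonneg (by linarith [(hx k).2])] at h2
    exact ⟨h1, h2⟩
  · intro h y hy
    obtain ⟨-, k, hk⟩ := mem_frontier_cube.1 hy
    have h1 : |x k - y k| ≤ dist x y := by
      have := PiLp.norm_apply_le (x - y) k
      simpa [dist_eq_norm] using this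
    refine le_trans ?_ h1
    rcases hk with hk | hk <;> rw [hk]
    · exact (h k).1.trans (le_abs_self _)
    · rw [abs_sub_comm]; exact (h k).2.trans (le_abs_self _)

theorem infDist_frontier_cube_le_add [NeZero n] {a x y : EuclideanSpace ℝ (Fin n)} {ℓ r : ℝ}
    (hx : x ∈ cube a ℓ) (hy : y ∈ cube a ℓ) (hxy : ∀ k, |x k - y k| ≤ r) :
    Metric.infDist x (frontier (cube a ℓ)) ≤ Metric.infDist y (frontier (cube a ℓ)) + r := by
  rw [← sub_le_iff_le_add, le_infDist_frontier_cube hy]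
  intro k
  have h := (le_infDist_frontier_cube hx).1 le_rfl k
  have := abs_le.1 (hxy k)
  constructor <;> linarith

theorem infDist_frontier_cube_le [NeZero n] {a x : EuclideanSpace ℝ (Fin n)} {ℓ : ℝ}
    (hx : x ∈ cube a ℓ) : Metric.infDist x (frontier (cube a ℓ)) ≤ ℓ := by
  have h := (le_infDist_frontier_cube hx).1 le_rfl 0
  have := (hx 0)
  linarith

theorem mem_cube_of_infDist_frontier [NeZero n] {a x y : EuclideanSpace ℝ (Fin n)} {ℓ r : ℝ}
    (hx : x ∈ cube a ℓ) (hr : r ≤ Metric.infDist x (frontier (cube a ℓ)))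
    (hxy : ∀ k, |x k - y k| ≤ r) : y ∈ cube a ℓ := by
  intro k
  have h := (le_infDist_frontier_cube hx).1 hr k
  have := abs_le.1 (hxy k)
  constructor <;> linarith

theorem abs_sub_le_of_mem_cube {a x y : EuclideanSpace ℝ (Fin n)} {ℓ : ℝ}
    (hx : x ∈ cube a ℓ) (hy : y ∈ cube a ℓ) (k : Fin n) : |x k - y k| ≤ ℓ := by
  have := hx k
  have := hy k
  rw [abs_le]; constructor <;> linarith

theorem cube_inter_cube_subset (a b : EuclideanSpace ℝ (Fin n)) (ℓ r : ℝ) :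
    cube a ℓ ∩ cube b r ⊆ closedBox (fun k => max (a k) (b k))
      (fun k => min (a k + ℓ) (b k + r)) := by
  rintro x ⟨hx, hy⟩ k
  exact ⟨max_le (hx k).1 (hy k).1, le_min (hx k).2 (hy k).2⟩

theorem volume_cube_inter_cube_le {a b : EuclideanSpace ℝ (Fin n)} {ℓ r : ℝ} :
    volume (cube a ℓ ∩ cube b r) ≤ ENNReal.ofReal (min ℓ r) ^ n := by
  refine (measure_mono (cube_inter_cube_subset a b ℓ r)).trans ?_
  rw [volume_closedBox]
  refine (Finset.prod_le_pow_card _ _ (ENNReal.ofReal (min ℓ r)) fun k _ => ?_).trans (by simp)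
  refine ENNReal.ofReal_le_ofReal (le_min ?_ ?_)
  · linarith [min_le_left (a k + ℓ) (b k + r), le_max_left (a k) (b k)]
  · linarith [min_le_right (a k + ℓ) (b k + r), le_max_right (a k) (b k)]

/-- The part of `cube a ℓ ∩ cube b r` at distance less than `s` from the boundary of `cube a ℓ`
is covered by `2 n` thin boxes. -/
theorem volume_near_frontier_le [NeZero n] {a b : EuclideanSpace ℝ (Fin n)} {ℓ r s : ℝ} :
    volume {x | x ∈ cube a ℓ ∩ cube b r ∧ Metric.infDist x (frontier (cube a ℓ)) < s} ≤
      2 * n * (ENNReal.ofReal s * ENNReal.ofReal (min ℓ r) ^ (n - 1)) := by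
  let lo : Fin n → ℝ := fun k => max (a k) (b k)
  let hi : Fin n → ℝ := fun k => min (a k + ℓ) (b k + r)
  have hlen : ∀ j, hi j - lo j ≤ min ℓ r := fun j => by
    refine le_min ?_ ?_
    · linarith [min_le_left (a j + ℓ) (b j + r), le_max_left (a j) (b j)]
    · linarith [min_le_right (a j + ℓ) (b j + r), le_max_right (a j) (b j)]
  have hbox : ∀ (k : Fin n) (u v : Fin n → ℝ), v k - u k ≤ s → (∀ j ≠ k, v j - u j ≤ min ℓ r) →
      volume (closedBox u v) ≤ ENNReal.ofReal s * ENNReal.ofReal (min ℓ r) ^ (n - 1) := by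
    intro k u v hk hj
    rw [volume_closedBox, ← Finset.mul_prod_erase _ _ (Finset.mem_univ k)]
    refine mul_le_mul' (ENNReal.ofReal_le_ofReal hk) ?_
    refine (Finset.prod_le_pow_card _ _ (ENNReal.ofReal (min ℓ r)) fun j hj' => ?_).trans
      (by simp [Finset.card_erase_of_mem])
    exact ENNReal.ofReal_le_ofReal (hj j (Finset.ne_of_mem_erase hj'))
  have hsub : {x | x ∈ cube a ℓ ∩ cube b r ∧ Metric.infDist x (frontier (cube a ℓ)) < s} ⊆
      ⋃ k : Fin n, (closedBox lo (Function.update hi k (a k + s)) ∪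
        closedBox (Function.update lo k (a k + ℓ - s)) hi) := by
    rintro x ⟨hx, hs⟩
    have hlohi := cube_inter_cube_subset a b ℓ r hx
    rw [← not_le, le_infDist_frontier_cube hx.1] at hs
    push Not at hs
    obtain ⟨k, hk⟩ := hs
    refine mem_iUnion.2 ⟨k, ?_⟩
    by_cases h : s ≤ x k - a k
    · right
      intro j
      rcases eq_or_ne j k with rfl | hj
      · have := hk h
        exact ⟨by simp; linarith, (hlohi j).2⟩
      · simpa only [Function.update_of_ne hj] using hlohi j
    · left
      intro j
      rcases eq_or_ne j k with rfl | hj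
      · exact ⟨(hlohi j).1, by simp; linarith⟩
      · simpa only [Function.update_of_ne hj] using hlohi j
  refine (measure_mono hsub).trans ((measure_iUnion_le _).trans ?_)
  rw [tsum_fintype]
  refine (Finset.sum_le_card_nsmul _ _ (2 * (ENNReal.ofReal s *
    ENNReal.ofReal (min ℓ r) ^ (n - 1))) fun k _ => ?_).trans (le_of_eq ?_)
  · refine (measure_union_le _ _).trans ?_
    rw [two_mul]
    refine add_le_add (hbox k _ _ ?_ ?_) (hbox k _ _ ?_ ?_)
    · simp only [Function.update_self, lo]
      linarith [le_max_left (a k) (b k)]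
    · intro j hj
      simpa [hj] using hlen j
    · simp only [Function.update_self, hi]
      linarith [min_le_left (a k + ℓ) (b k + r)]
    · intro j hj
      simpa [hj] using hlen j
  · simp only [Finset.card_univ, Fintype.card_fin, nsmul_eq_mul]
    ring

end CubeGeometry

/-! ### The bump as a function of the distance to the boundary -/

noncomputable section BumpProfile

/-- The truncated ratio `4 d / ℓ`, clamped to `[2 ^ (-μ), 1]`. -/
def clampedRatio (ℓ μ d : ℝ) : ℝ := min (max (4 * d / ℓ) ((2 : ℝ) ^ (-μ))) 1

/-- The Brezis-Nirenberg bump function as a function of the distance to the boundary. -/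
def bumpProfile (ℓ μ d : ℝ) : ℝ := 1 + 1 / μ * Real.logb 2 (clampedRatio ℓ μ d)

theorem rpow_neg_le_clampedRatio {ℓ μ d : ℝ} (hμ : 0 ≤ μ) :
    (2 : ℝ) ^ (-μ) ≤ clampedRatio ℓ μ d :=
  le_min (le_max_right _ _) (Real.rpow_le_one_of_one_le_of_nonpos (by norm_num) (by linarith))

theorem clampedRatio_pos {ℓ μ d : ℝ} : 0 < clampedRatio ℓ μ d :=
  lt_min (lt_max_of_lt_right (Real.rpow_pos_of_pos (by norm_num) _)) one_pos

theorem DyadicCube.side_pos {n : ℕ} (S : DyadicCube n) : 0 < S.side :=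
  zpow_pos (by norm_num) _

/-- Clamping below at `2 ^ (-μ)`, where the profile is zero, encodes the positive part and the case
d = 0; clamping above at 1 encodes the plateau. -/
theorem DyadicCube.bump_eq {n : ℕ} (S : DyadicCube n) {μ : ℝ} (hμ : 0 < μ)
    (x : EuclideanSpace ℝ (Fin n)) :
    S.bump μ x = bumpProfile S.side μ (Metric.infDist x (frontier S.carrier)) := by
  have hs := S.side_pos
  have hd : 0 ≤ Metric.infDist x (frontier S.carrier) := Metric.infDist_nonneg
  have h2μ : (0 : ℝ) < 2 ^ (-μ) := Real.rpow_pos_of_pos (by norm_num) _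
  have h2μ' : (2 : ℝ) ^ (-μ) ≤ 1 :=
    Real.rpow_le_one_of_one_le_of_nonpos (by norm_num) (by linarith)
  have hbot : 1 + 1 / μ * Real.logb 2 ((2 : ℝ) ^ (-μ)) = 0 := by
    rw [Real.logb_rpow (by norm_num) (by norm_num)]
    field_simp
    ring
  unfold DyadicCube.bump bumpProfile clampedRatio
  dsimp only
  generalize Metric.infDist x (frontier S.carrier) = d at *
  split_ifs with h1 h2
  · have : 1 ≤ 4 * d / S.side := by rw [le_div_iff₀ hs]; linarith
    rw [min_eq_right (le_max_of_le_left this)]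
    simp
  · subst h2
    rw [mul_zero, zero_div, max_eq_right h2μ.le, min_eq_left h2μ', hbot]
  · have hd' : 0 < d := lt_of_le_of_ne hd (Ne.symm h2)
    have hq : 0 < 4 * d / S.side := by positivity
    have h3 : 4 * d / S.side ≤ 1 := by rw [div_le_one hs]; linarith
    have h4 : Real.logb 2 (S.side / (4 * d)) = - Real.logb 2 (4 * d / S.side) := by
      rw [← Real.logb_inv, inv_div]
    have hμ' : 0 < 1 / μ := by positivity
    rw [h4, min_eq_left (max_le h3 h2μ')]
    rcases le_total (4 * d / S.side) (2 ^ (-μ)) with h | h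
    · rw [max_eq_right h, hbot, max_eq_left]
      have := Real.logb_le_logb_of_le (b := 2) (by norm_num) hq h
      have := mul_le_mul_of_nonneg_left this hμ'.le
      linarith
    · rw [max_eq_left h, max_eq_right]
      · ring
      · have := Real.logb_le_logb_of_le (b := 2) (by norm_num) h2μ h
        have := mul_le_mul_of_nonneg_left this hμ'.le
        linarith

theorem continuous_bumpProfile (ℓ μ : ℝ) : Continuous (bumpProfile ℓ μ) := by
  unfold bumpProfile
  have h : Continuous (clampedRatio ℓ μ) := by
    unfold clampedRatio
    fun_prop
  refine continuous_const.add (continuous_const.mul ?_)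
  simp only [Real.logb]
  exact (h.log fun d => clampedRatio_pos.ne').div_const _

theorem DyadicCube.continuous_bump {n : ℕ} (S : DyadicCube n) {μ : ℝ} (hμ : 0 < μ) :
    Continuous (S.bump μ) := by
  rw [funext (S.bump_eq hμ)]
  exact (continuous_bumpProfile _ _).comp (Metric.continuous_infDist_pt _)

theorem abs_logb_sub_logb_le {a b q : ℝ} (ha : 0 < a) (hb : 0 < b) (hq : 0 < q)
    (hab : a ≤ q * b) (hba : b ≤ q * a) :
    |Real.logb 2 a - Real.logb 2 b| ≤ Real.logb 2 q := by
  have h1 := Real.logb_le_logb_of_le (b := 2) (by norm_num) ha hab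
  have h2 := Real.logb_le_logb_of_le (b := 2) (by norm_num) hb hba
  rw [Real.logb_mul hq.ne' hb.ne'] at h1
  rw [Real.logb_mul hq.ne' ha.ne'] at h2
  rw [abs_le]; constructor <;> linarith

theorem abs_bumpProfile_sub_le_logb {ℓ μ d d' q : ℝ} (hμ : 0 < μ) (hq : 0 < q)
    (h : clampedRatio ℓ μ d ≤ q * clampedRatio ℓ μ d')
    (h' : clampedRatio ℓ μ d' ≤ q * clampedRatio ℓ μ d) :
    |bumpProfile ℓ μ d - bumpProfile ℓ μ d'| ≤ 1 / μ * Real.logb 2 q := by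
  unfold bumpProfile
  rw [add_sub_add_left_eq_sub, ← mul_sub, abs_mul, abs_of_pos (by positivity : 0 < 1 / μ)]
  exact mul_le_mul_of_nonneg_left
    (abs_logb_sub_logb_le clampedRatio_pos clampedRatio_pos hq h h') (by positivity)

theorem clampedRatio_le_mul {ℓ μ d ℓ' μ' d' q : ℝ} (hq : 1 ≤ q)
    (h : 4 * d / ℓ ≤ q * (4 * d' / ℓ')) (h2 : (2 : ℝ) ^ (-μ) ≤ q * 2 ^ (-μ')) :
    clampedRatio ℓ μ d ≤ q * clampedRatio ℓ' μ' d' := by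
  unfold clampedRatio
  have hq0 : 0 ≤ q := by linarith
  rw [mul_min_of_nonneg _ _ hq0, mul_max_of_nonneg _ _ hq0]
  exact min_le_min (max_le_max h h2) (by linarith)

/-- The profile oscillates by at most `1 / μ` when the distance is at most doubled. -/
theorem abs_bumpProfile_sub_le {ℓ μ d d' q : ℝ} (hℓ : 0 < ℓ) (hμ : 0 < μ) (hq : 1 ≤ q)
    (h : d ≤ q * d') (h' : d' ≤ q * d) :
    |bumpProfile ℓ μ d - bumpProfile ℓ μ d'| ≤ 1 / μ * Real.logb 2 q := by
  have h2μ : (0 : ℝ) < 2 ^ (-μ) := Real.rpow_pos_of_pos (by norm_num) _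
  refine abs_bumpProfile_sub_le_logb hμ (by linarith) (clampedRatio_le_mul hq ?_ (by nlinarith))
    (clampedRatio_le_mul hq ?_ (by nlinarith))
  · rw [← mul_div_assoc]; exact div_le_div_of_nonneg_right (by linarith) hℓ.le
  · rw [← mul_div_assoc]; exact div_le_div_of_nonneg_right (by linarith) hℓ.le

theorem bumpProfile_eq_zero {ℓ μ d : ℝ} (hℓ : 0 < ℓ) (hμ : 0 < μ) (h : d ≤ ℓ / 4 * 2 ^ (-μ)) :
    bumpProfile ℓ μ d = 0 := by
  have h1 : 4 * d / ℓ ≤ (2 : ℝ) ^ (-μ) := by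
    rw [div_le_iff₀ hℓ]; linarith
  unfold bumpProfile clampedRatio
  rw [max_eq_right h1, min_eq_left
    (Real.rpow_le_one_of_one_le_of_nonpos (by norm_num) (by linarith)),
    Real.logb_rpow (by norm_num) (by norm_num)]
  field_simp
  ring

/-- The profile is constant from ℓ/4 on, so the depth r may be replaced by min(ℓ, r), the scale at
which volumes are counted. -/
theorem bumpProfile_min {ℓ μ r : ℝ} (hℓ : 0 < ℓ) :
    bumpProfile ℓ μ (min r ℓ) = bumpProfile ℓ μ r := by
  unfold bumpProfile
  congr 3
  unfold clampedRatio
  rcases le_total r ℓ with h | h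
  · rw [min_eq_left h]
  · have h1 : 1 ≤ 4 * ℓ / ℓ := by rw [le_div_iff₀ hℓ]; linarith
    have h2 : 1 ≤ 4 * r / ℓ := by rw [le_div_iff₀ hℓ]; linarith
    rw [min_eq_right h, min_eq_right (le_max_of_le_left h1), min_eq_right (le_max_of_le_left h2)]

/-- The lower clamp keeps the argument of the logarithm away from zero, so the profile is Lipschitz:
an additive change r is a relative change of at most r / (ℓ/4 · 2^(-μ)), and log(1 + x) ≤ x. -/
theorem abs_bumpProfile_sub_le_of_abs_sub_le {ℓ μ d d' r : ℝ} (hℓ : 0 < ℓ) (hμ : 0 < μ)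
    (hr : |d - d'| ≤ r) :
    |bumpProfile ℓ μ d - bumpProfile ℓ μ d'| ≤
      1 / μ * (r / (ℓ / 4 * 2 ^ (-μ)) / Real.log 2) := by
  have h2μ : (0 : ℝ) < 2 ^ (-μ) := Real.rpow_pos_of_pos (by norm_num) _
  have hr0 : 0 ≤ r := (abs_nonneg _).trans hr
  have hx : 0 ≤ r / (ℓ / 4 * 2 ^ (-μ)) := by positivity
  have key : ∀ u v : ℝ, u ≤ v + r →
      clampedRatio ℓ μ u ≤ (1 + r / (ℓ / 4 * 2 ^ (-μ))) * clampedRatio ℓ μ v := by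
    intro u v huv
    have h1 := rpow_neg_le_clampedRatio (ℓ := ℓ) (d := v) hμ.le
    have h2 : 4 * r / ℓ ≤ r / (ℓ / 4 * 2 ^ (-μ)) * clampedRatio ℓ μ v := by
      refine le_trans (le_of_eq ?_) (mul_le_mul_of_nonneg_left h1 hx)
      field_simp
    have h3 : 4 * u / ℓ ≤ 4 * v / ℓ + 4 * r / ℓ := by
      rw [← add_div]; gcongr; linarith
    have h4 : 0 ≤ 4 * r / ℓ := by positivity
    rw [add_mul, one_mul]
    refine le_trans ?_ (add_le_add_right h2 _)
    unfold clampedRatio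
    rw [← min_add_add_right, ← max_add_add_right]
    exact min_le_min (max_le_max h3 (by linarith)) (by linarith)
  have hd := abs_le.1 hr
  refine (abs_bumpProfile_sub_le_logb hμ (by linarith) (key d d' (by linarith))
    (key d' d (by linarith))).trans ?_
  gcongr
  rw [Real.logb]
  gcongr
  have := Real.log_le_sub_one_of_pos (by linarith : 0 < 1 + r / (ℓ / 4 * 2 ^ (-μ)))
  linarith

/-- The deviation of the profile from its value at `r` is dominated by a sum of indicators. -/
theorem ofReal_abs_bumpProfile_sub_le {ℓ μ d r : ℝ} (hℓ : 0 < ℓ) (hμ : 0 < μ) (hr : 0 < r)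
    (hd : 0 ≤ d) (hdr : d ≤ 2 * min ℓ r) :
    ENNReal.ofReal |bumpProfile ℓ μ d - bumpProfile ℓ μ r| ≤ ENNReal.ofReal (1 / μ) *
      (1 + ∑' m : ℕ, if d < min ℓ r / 2 ^ m then 1 else 0) := by
  rw [← bumpProfile_min (r := r) hℓ, min_comm r]
  set ρ := min ℓ r
  have hρ : 0 < ρ := lt_min hℓ hr
  -- On the boundary every layer contains the point and the right side is infinite.
  rcases eq_or_lt_of_le hd with rfl | hd0
  · have : ∑' m : ℕ, (if (0 : ℝ) < ρ / 2 ^ m then (1 : ℝ≥0∞) else 0) = ∞ := by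
      rw [← ENNReal.tsum_const_eq_top_of_ne_zero (α := ℕ) one_ne_zero]
      exact tsum_congr fun m => if_pos (by positivity)
    rw [this, add_top, ENNReal.mul_top (by simpa using hμ)]
    exact le_top
  rcases le_total ρ d with h | h
  · have := abs_bumpProfile_sub_le (μ := μ) hℓ hμ one_le_two hdr (by linarith)
    refine (ENNReal.ofReal_le_ofReal this).trans ?_
    rw [Real.logb_self_eq_one (by norm_num), mul_one]
    exact le_mul_of_one_le_right' le_self_add
  · have hq : 1 ≤ ρ / d := (one_le_div hd0).2 h
    have h0 : 0 ≤ Real.logb 2 (ρ / d) := Real.logb_nonneg (by norm_num) hq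
    have := abs_bumpProfile_sub_le (μ := μ) (d := d) (d' := ρ) hℓ hμ hq
      (by nlinarith) (by field_simp; exact le_rfl)
    refine (ENNReal.ofReal_le_ofReal this).trans ?_
    rw [ENNReal.ofReal_mul (by positivity)]
    refine mul_le_mul_right ((?_ : _ ≤ _).trans le_add_self) _
    set N := ⌈Real.logb 2 (ρ / d)⌉₊
    calc ENNReal.ofReal (Real.logb 2 (ρ / d)) ≤ (N : ℝ≥0∞) := by
          rw [← ENNReal.ofReal_natCast]
          exact ENNReal.ofReal_le_ofReal (Nat.le_ceil _)
      _ = ∑ m ∈ Finset.range N, (if d < ρ / 2 ^ m then (1 : ℝ≥0∞) else 0) := by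
          rw [Finset.sum_congr rfl (g := fun _ => (1 : ℝ≥0∞))]
          · simp
          · intro m hm
            have hm' : (m : ℝ) < Real.logb 2 (ρ / d) := Nat.lt_ceil.1 (Finset.mem_range.1 hm)
            rw [Real.lt_logb_iff_rpow_lt (by norm_num) (by positivity), Real.rpow_natCast,
              lt_div_iff₀ hd0] at hm'
            refine if_pos ?_
            rw [lt_div_iff₀ (by positivity)]
            linarith
      _ ≤ _ := ENNReal.sum_le_tsum _

/-- The heights of the glued bumps on adjacent cubes, at equal distance from the boundary. -/
theorem abs_mul_bumpProfile_sub_le {l l' ℓ ℓ' μ μ' r C : ℝ} (hℓ : 0 < ℓ) (hℓ' : 0 < ℓ')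
    (hμ : 0 < μ) (hμ' : 0 < μ') (hr : 0 ≤ r) (h1 : ℓ ≤ 4 * ℓ') (h2 : ℓ' ≤ 4 * ℓ)
    (hC : |μ - μ'| ≤ C) :
    |l * bumpProfile ℓ μ r - l' * bumpProfile ℓ' μ' r| ≤
      2 * |l - l'| + |l| / μ * (2 + 2 * C) := by
  have hC0 : 0 ≤ C := (abs_nonneg _).trans hC
  have hCab := abs_le.1 hC
  have h2C : (4 : ℝ) ≤ 2 ^ (2 + C) := by
    calc (4 : ℝ) = 2 ^ (2 : ℝ) := by norm_num
      _ ≤ _ := Real.rpow_le_rpow_of_exponent_le (by norm_num) (by linarith)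
  have hq : (1 : ℝ) ≤ 2 ^ (2 + C) := by linarith
  -- In the factor `2 ^ (2 + C)`, 4 absorbs the ratio of sidelengths and `2 ^ C` the difference of
  -- the exponents.
  have key : ∀ a b u v : ℝ, 0 < a → 0 < b → b ≤ 4 * a → v - u ≤ C →
      clampedRatio a u r ≤ 2 ^ (2 + C) * clampedRatio b v r := by
    intro a b u v ha hb hba huv
    refine clampedRatio_le_mul hq ?_ ?_
    · have : 4 * r / a ≤ 4 * (4 * r / b) := by
        rw [div_le_iff₀ ha]
        have : 4 * (4 * r / b) * a = 4 * r * (4 * a / b) := by ring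
        rw [this]
        refine le_mul_of_one_le_right (by positivity) ?_
        rw [le_div_iff₀ hb]; linarith
      exact this.trans (mul_le_mul_of_nonneg_right h2C (by positivity))
    · rw [← Real.rpow_add (by norm_num)]
      exact Real.rpow_le_rpow_of_exponent_le (by norm_num) (by linarith)
  have hlog := abs_logb_sub_logb_le clampedRatio_pos clampedRatio_pos (by linarith)
    (key ℓ ℓ' μ μ' hℓ hℓ' h2 (by linarith)) (key ℓ' ℓ μ' μ hℓ' hℓ h1 (by linarith))
  rw [Real.logb_rpow (by norm_num) (by norm_num)] at hlog
  have hg0 : Real.logb 2 (clampedRatio ℓ' μ' r) ≤ 0 :=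
    Real.logb_nonpos (by norm_num) clampedRatio_pos.le (min_le_right _ _)
  have hg1 : -μ' ≤ Real.logb 2 (clampedRatio ℓ' μ' r) := by
    have := Real.logb_le_logb_of_le (b := 2) (by norm_num) (Real.rpow_pos_of_pos (by norm_num) _)
      (rpow_neg_le_clampedRatio (ℓ := ℓ') (d := r) hμ'.le)
    rwa [Real.logb_rpow (by norm_num) (by norm_num)] at this
  unfold bumpProfile
  generalize Real.logb 2 (clampedRatio ℓ' μ' r) = g' at *
  generalize Real.logb 2 (clampedRatio ℓ μ r) = g at *
  have hθ : |g' / μ'| ≤ 1 := by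
    rw [abs_div, abs_of_pos hμ', div_le_one hμ', abs_le]
    constructor <;> linarith
  -- This splitting involves l' only through l - l', so a bound on |l|/μ for one of the two cubes
  -- suffices.
  have hid : l * (1 + 1 / μ * g) - l' * (1 + 1 / μ' * g') =
      (l - l') + (g' / μ') * (l - l') + l / μ * (g - g') + (g' / μ') * (l / μ * (μ' - μ)) := by
    field_simp
    ring
  have hl : |l / μ| = |l| / μ := by rw [abs_div, abs_of_pos hμ]
  have hl0 : 0 ≤ |l| / μ := by positivity
  rw [hid]
  have e2 : |g' / μ' * (l - l')| ≤ |l - l'| := by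
    rw [abs_mul]; exact mul_le_of_le_one_left (abs_nonneg _) hθ
  have e3 : |l / μ * (g - g')| ≤ |l| / μ * (2 + C) := by
    rw [abs_mul, hl]; exact mul_le_mul_of_nonneg_left hlog hl0
  have e4 : |g' / μ' * (l / μ * (μ' - μ))| ≤ |l| / μ * C := by
    rw [abs_mul, abs_mul, hl, abs_sub_comm μ']
    exact (mul_le_of_le_one_left (by positivity) hθ).trans (mul_le_mul_of_nonneg_left hC hl0)
  refine (abs_add_le _ _).trans ?_
  have := (abs_add_le (l - l' + g' / μ' * (l - l')) (l / μ * (g - g')))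
  have := abs_add_le (l - l') (g' / μ' * (l - l'))
  linarith

end BumpProfile

/-! ### Mean oscillation against a constant -/

section MeanOscillation

variable {n : ℕ}

/-- Any constant c may replace the average at the cost of a factor 2, since the average is itself
within K of c. -/
theorem meanOsc_le {f : EuclideanSpace ℝ (Fin n) → ℝ} {a : EuclideanSpace ℝ (Fin n)} {ℓ c K : ℝ}
    (hℓ : 0 < ℓ) (hK : 0 ≤ K) (hf : ContinuousOn f (cube a ℓ))
    (h : ∫⁻ x in cube a ℓ, ENNReal.ofReal |f x - c| ≤ ENNReal.ofReal K * ENNReal.ofReal ℓ ^ n) :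
    meanOsc f (cube a ℓ) ≤ 2 * K := by
  have hm : (0 : ℝ) < ℓ ^ n := by positivity
  have hvol : volume.real (cube a ℓ) = ℓ ^ n := by
    rw [measureReal_def, volume_cube, ENNReal.toReal_pow, ENNReal.toReal_ofReal hℓ.le]
  have hQ := isCompact_cube a ℓ
  have hfin : volume (cube a ℓ) ≠ ∞ := hQ.measure_ne_top
  have hint : IntegrableOn f (cube a ℓ) := hf.integrableOn_compact hQ
  have hconst : ∀ d : ℝ, IntegrableOn (fun _ => d) (cube a ℓ) := fun d =>
    integrableOn_const hfin
  have habs : ∀ d : ℝ, IntegrableOn (fun x => |f x - d|) (cube a ℓ) := fun d =>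
    (hint.sub (hconst d)).abs
  have hI : ∫ x in cube a ℓ, |f x - c| ≤ K * ℓ ^ n := by
    rw [integral_eq_lintegral_of_nonneg_ae (ae_of_all _ fun x => abs_nonneg _)
      (habs c).aestronglyMeasurable]
    refine ENNReal.toReal_le_of_le_ofReal (by positivity) (h.trans (le_of_eq ?_))
    rw [ENNReal.ofReal_mul hK, ENNReal.ofReal_pow hℓ.le]
  unfold meanOsc
  simp only [setAverage_eq, hvol, smul_eq_mul]
  set A := (ℓ ^ n)⁻¹ * ∫ x in cube a ℓ, f x with hA
  have hA' : |c - A| ≤ K := by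
    have h1 : ∫ x in cube a ℓ, (f x - c) = (A - c) * ℓ ^ n := by
      rw [integral_sub hint (hconst c), setIntegral_const, hvol, hA, smul_eq_mul]
      field_simp
    have h2 := (abs_integral_le_integral_abs (f := fun x => f x - c)
      (μ := volume.restrict (cube a ℓ))).trans hI
    rw [h1, abs_mul, abs_of_pos hm] at h2
    rw [abs_sub_comm]
    exact le_of_mul_le_mul_right h2 hm
  have h3 : ∫ x in cube a ℓ, |f x - A| ≤ ∫ x in cube a ℓ, (|f x - c| + K) := by
    refine integral_mono (habs A) ((habs c).add (hconst K))
      fun x => ?_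
    have := abs_sub_le (f x) c A
    simp only
    linarith
  rw [integral_add (habs c) (hconst K), setIntegral_const, hvol,
    smul_eq_mul] at h3
  rw [inv_mul_le_iff₀ hm]
  linarith

theorem meanOsc_le_of_abs_sub_le {f : EuclideanSpace ℝ (Fin n) → ℝ}
    {a : EuclideanSpace ℝ (Fin n)} {ℓ e : ℝ} (hℓ : 0 < ℓ) (he : 0 ≤ e)
    (hf : ContinuousOn f (cube a ℓ)) (h : ∀ x ∈ cube a ℓ, ∀ y ∈ cube a ℓ, |f x - f y| ≤ e) :
    meanOsc f (cube a ℓ) ≤ 2 * e := by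
  have ha : a ∈ cube a ℓ := fun k => ⟨le_rfl, by linarith⟩
  refine meanOsc_le (c := f a) hℓ he hf ?_
  rw [← volume_cube a ℓ, ← setLIntegral_const]
  exact setLIntegral_mono measurable_const fun x hx => ENNReal.ofReal_le_ofReal (h x hx a ha)

end MeanOscillation

/-! ### Chaining along a connected set -/

/-- The variation of a real quantity over a finite closed cover of a preconnected set is at most
the number of members that meet the set times the largest jump between intersecting members. -/
theorem ofReal_abs_sub_le_tsum_of_isPreconnected {X ι : Type*} [TopologicalSpace X] [Finite ι]
    {T : ι → Set X} {K : Set X} {V : ι → ℝ} {e : ℝ} (hT : ∀ i, IsClosed (T i))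
    (hK : IsPreconnected K) (hKT : K ⊆ ⋃ i, T i) (he : 0 ≤ e)
    (hV : ∀ i j, i ≠ j → (T i ∩ T j).Nonempty → |V i - V j| ≤ e) {i₀ i₁ : ι}
    (h₀ : (K ∩ T i₀).Nonempty) (h₁ : (K ∩ T i₁).Nonempty) :
    ENNReal.ofReal |V i₁ - V i₀| ≤
      ∑' j, {j | (K ∩ T j).Nonempty}.indicator (fun _ => ENNReal.ofReal e) j := by
  wlog hle : V i₀ ≤ V i₁ generalizing i₀ i₁
  · rw [abs_sub_comm]
    exact this h₁ h₀ (le_of_not_ge hle)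
  rw [abs_of_nonneg (sub_nonneg.2 hle), ← Real.volume_Icc]
  -- An uncovered height t would split K into two closed parts, the members with V_j + e < t and
  -- those with V_j > t. By connectedness they meet, giving a jump larger than e.
  have hcov : Icc (V i₀) (V i₁) ⊆
      ⋃ j, {t | (K ∩ T j).Nonempty ∧ t ∈ Icc (V j) (V j + e)} := by
    intro t ht
    by_contra hcon
    simp only [mem_iUnion, mem_ofPred_eq, mem_Icc, not_exists, not_and, not_le] at hcon
    have hA : IsClosed (⋃ j : {j // V j + e < t}, T j) := isClosed_iUnion_of_finite fun j => hT _
    have hB : IsClosed (⋃ j : {j // t < V j}, T j) := isClosed_iUnion_of_finite fun j => hT _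
    obtain ⟨x, -, hxA, hxB⟩ := isPreconnected_closed_iff.1 hK _ _ hA hB (by
        intro x hx
        obtain ⟨j, hj⟩ := mem_iUnion.1 (hKT hx)
        rcases le_or_gt (V j) t with h | h
        · exact Or.inl (mem_iUnion.2 ⟨⟨j, hcon j ⟨x, hx, hj⟩ h⟩, hj⟩)
        · exact Or.inr (mem_iUnion.2 ⟨⟨j, h⟩, hj⟩))
      (by
        obtain ⟨x, hx, hj⟩ := h₀
        exact ⟨x, hx, mem_iUnion.2 ⟨⟨i₀, hcon i₀ ⟨x, hx, hj⟩ ht.1⟩, hj⟩⟩)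
      (by
        obtain ⟨x, hx, hj⟩ := h₁
        refine ⟨x, hx, mem_iUnion.2 ⟨⟨i₁, ?_⟩, hj⟩⟩
        by_contra hlt
        have := hcon i₁ ⟨x, hx, hj⟩ (not_lt.1 hlt)
        linarith [ht.2])
    obtain ⟨⟨i, hi⟩, hxi⟩ := mem_iUnion.1 hxA
    obtain ⟨⟨j, hj⟩, hxj⟩ := mem_iUnion.1 hxB
    have hij : i ≠ j := by
      rintro rfl
      linarith
    have := abs_le.1 (hV i j hij ⟨x, hxi, hxj⟩)
    linarith
  refine (measure_mono hcov).trans ((measure_iUnion_le _).trans (ENNReal.tsum_le_tsum fun j => ?_))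
  by_cases hj : (K ∩ T j).Nonempty
  · rw [indicator_of_mem (show j ∈ {j | (K ∩ T j).Nonempty} from hj)]
    refine (measure_mono fun t ht => ht.2).trans ?_
    rw [Real.volume_Icc]
    simp
  · simp [hj]

/-! ### Whitney families: packing, local finiteness, continuity -/

section Whitney

variable {n : ℕ} {ι : Type*}

theorem DyadicCube.isClosed_carrier (S : DyadicCube n) : IsClosed S.carrier :=
  (isCompact_cube _ _).isClosed

/-- The truncated volumes of non-overlapping cubes that meet a given cube sum up to at most
the volume of its threefold enlargement. -/
theorem tsum_min_side_pow_le [Countable ι] {S : ι → DyadicCube n}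
    (hdisj : ∀ i j, i ≠ j → Disjoint (interior (S i).carrier) (interior (S j).carrier))
    (b : EuclideanSpace ℝ (Fin n)) (r : ℝ) :
    ∑' i : {i // ((S i).carrier ∩ cube b r).Nonempty}, ENNReal.ofReal (min (S i).side r) ^ n ≤
      ENNReal.ofReal (3 * r) ^ n := by
  choose x hx using fun i : {i // ((S i).carrier ∩ cube b r).Nonempty} => i.2
  let ρ : {i // ((S i).carrier ∩ cube b r).Nonempty} → ℝ := fun i => min (S i).side r
  -- Inside each cube, choose a subcube of side min(ℓ_i, r) whose closure contains the meeting
  -- point; these are disjoint and stay within r of the given cube.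
  let lo : {i // ((S i).carrier ∩ cube b r).Nonempty} → Fin n → ℝ :=
    fun i k => max ((S i).corner k) (x i k - ρ i)
  have hsub : ∀ i, openBox (lo i) (fun k => lo i k + ρ i) ⊆ interior (S i).carrier := by
    intro i y hy
    rw [DyadicCube.carrier, interior_cube]
    intro k
    have h1 := hy k
    have h2 := (hx i).1 k
    have h3 : ρ i ≤ (S i).side := min_le_left _ _
    refine ⟨(le_max_left _ _).trans_lt h1.1, h1.2.trans_le ?_⟩
    simp only [lo, ← max_add_add_right]
    exact max_le (by linarith) (by linarith)
  have hsub' : ∀ i, openBox (lo i) (fun k => lo i k + ρ i) ⊆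
      closedBox (fun k => b k - r) (fun k => b k - r + 3 * r) := by
    intro i y hy k
    have h1 := hy k
    have h2 := (hx i).1 k
    have h4 := (hx i).2 k
    have h3 : ρ i ≤ r := min_le_right _ _
    have h5 : lo i k + ρ i ≤ x i k + ρ i := by
      simp only [lo, add_le_add_iff_right]
      refine max_le h2.1 ?_
      have : 0 ≤ ρ i := le_min (S i).side_pos.le (by linarith)
      linarith
    have h6 := le_max_right ((S i).corner k) (x i k - ρ i)
    simp only [lo] at h1 h5
    exact ⟨by linarith, by linarith⟩
  calc ∑' i : {i // ((S i).carrier ∩ cube b r).Nonempty}, ENNReal.ofReal (min (S i).side r) ^ n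
      = ∑' i, volume (openBox (lo i) (fun k => lo i k + ρ i)) := by
        refine tsum_congr fun i => ?_
        rw [volume_openBox]
        simp [ρ]
    _ = volume (⋃ i, openBox (lo i) (fun k => lo i k + ρ i)) := by
        rw [measure_iUnion _ fun i => measurableSet_openBox _ _]
        intro i j hij
        exact (hdisj i j (Subtype.coe_injective.ne hij)).mono (hsub i) (hsub j)
    _ ≤ volume (closedBox (fun k => b k - r) (fun k => b k - r + 3 * r)) :=
        measure_mono (iUnion_subset hsub')
    _ = ENNReal.ofReal (3 * r) ^ n := by
        rw [volume_closedBox]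
        simp

theorem dist_le_sqrt_mul {x y : EuclideanSpace ℝ (Fin n)} {s : ℝ} (hs : 0 ≤ s)
    (h : ∀ k, |x k - y k| ≤ s) : dist x y ≤ √n * s := by
  rw [EuclideanSpace.dist_eq]
  refine Real.sqrt_le_iff.2 ⟨by positivity, ?_⟩
  rw [mul_pow, Real.sq_sqrt (Nat.cast_nonneg n)]
  refine (Finset.sum_le_card_nsmul _ _ (s ^ 2) fun k _ => ?_).trans (by simp)
  exact pow_le_pow_left₀ dist_nonneg (h k) 2

/-- A cube of Whitney type is close to the complement, from any of its points. -/
theorem exists_notMem_unionInterior {S : ι → DyadicCube n} {i : ι}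
    (hW : ∃ x ∈ (S i).carrier, ∃ y ∉ DyadicCube.unionInterior S,
      dist x y ≤ 4 * √(n : ℝ) * (S i).side) {p : EuclideanSpace ℝ (Fin n)}
    (hp : p ∈ (S i).carrier) :
    ∃ y ∉ DyadicCube.unionInterior S, ∀ k, |p k - y k| ≤ (1 + 4 * √(n : ℝ)) * (S i).side := by
  obtain ⟨x, hx, y, hy, hxy⟩ := hW
  refine ⟨y, hy, fun k => ?_⟩
  have h1 := abs_sub_le_of_mem_cube hp hx k
  have h2 : |x k - y k| ≤ dist x y := by
    simpa [dist_eq_norm] using PiLp.norm_apply_le (x - y) k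
  have h3 := abs_sub_le (p k) (x k) (y k)
  linarith

/-- A Whitney family is locally finite in the interior of its union. -/
theorem finite_meets_cube [Countable ι] {S : ι → DyadicCube n}
    (hdisj : ∀ i j, i ≠ j → Disjoint (interior (S i).carrier) (interior (S j).carrier))
    (hW : ∀ i, ∃ x ∈ (S i).carrier, ∃ y ∉ DyadicCube.unionInterior S,
      dist x y ≤ 4 * √(n : ℝ) * (S i).side)
    {b : EuclideanSpace ℝ (Fin n)} {r : ℝ} (hr : 0 < r)
    (hQ : cube b r ⊆ DyadicCube.unionInterior S) :
    Finite {i // ((S i).carrier ∩ cube b r).Nonempty} := by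
  obtain ⟨ε, hε, hthick⟩ := (isCompact_cube b r).exists_thickening_subset_open
    (isOpen_interior : IsOpen (DyadicCube.unionInterior S)) hQ
  have hB : 0 < √(n : ℝ) * (1 + 4 * √(n : ℝ)) + 1 := by positivity
  set c := ε / (√(n : ℝ) * (1 + 4 * √(n : ℝ)) + 1) with hc
  have hc0 : 0 < c := by positivity
  -- A small cube meeting the compact cube would bring the complement closer than ε. With
  -- sidelengths at least c, infinitely many cubes would make the packing sum diverge.
  have hlow : ∀ i : {i // ((S i).carrier ∩ cube b r).Nonempty}, c ≤ (S i).side := by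
    rintro ⟨i, p, hp, hpQ⟩
    obtain ⟨y, hy, hpy⟩ := exists_notMem_unionInterior (hW i) hp
    have h1 : ε ≤ dist p y := by
      by_contra! hlt
      exact hy (hthick (Metric.mem_thickening_iff.2 ⟨p, hpQ, by rwa [dist_comm]⟩))
    have h2 := dist_le_sqrt_mul (by have := (S i).side_pos; positivity) hpy
    rw [hc, div_le_iff₀ hB]
    have := (S i).side_pos
    nlinarith
  have hsum := tsum_min_side_pow_le hdisj b r
  have hfin := ENNReal.finite_const_le_of_tsum_ne_top
    (ne_top_of_le_ne_top (by finiteness) hsum)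
    (ε := ENNReal.ofReal (min c r) ^ n)
    (pow_ne_zero _ (by simpa using lt_min hc0 hr))
  refine Set.finite_univ_iff.1 (hfin.subset fun i _ => ?_)
  exact pow_le_pow_left' (ENNReal.ofReal_le_ofReal (min_le_min_right _ (hlow i))) n

theorem exists_mem_carrier {S : ι → DyadicCube n} {x : EuclideanSpace ℝ (Fin n)}
    (hx : x ∈ DyadicCube.unionInterior S) : ∃ i, x ∈ (S i).carrier :=
  mem_iUnion.1 (interior_subset hx)

theorem continuousOn_cube_of_glued [Countable ι] {S : ι → DyadicCube n}
    {f : EuclideanSpace ℝ (Fin n) → ℝ}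
    (hdisj : ∀ i j, i ≠ j → Disjoint (interior (S i).carrier) (interior (S j).carrier))
    (hW : ∀ i, ∃ x ∈ (S i).carrier, ∃ y ∉ DyadicCube.unionInterior S,
      dist x y ≤ 4 * √(n : ℝ) * (S i).side)
    (hf : ∀ i, ContinuousOn f (S i).carrier)
    {b : EuclideanSpace ℝ (Fin n)} {r : ℝ} (hr : 0 < r)
    (hQ : cube b r ⊆ DyadicCube.unionInterior S) : ContinuousOn f (cube b r) := by
  have := finite_meets_cube hdisj hW hr hQ
  refine ((locallyFinite_of_finite fun i : {i // ((S i).carrier ∩ cube b r).Nonempty} =>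
    (S i).carrier).continuousOn_iUnion (fun i => (S i).isClosed_carrier) fun i => hf i).mono ?_
  intro x hx
  obtain ⟨i, hi⟩ := exists_mem_carrier (hQ hx)
  exact mem_iUnion.2 ⟨⟨i, x, hi, hx⟩, hi⟩

theorem continuousOn_unionInterior_of_glued [Countable ι] {S : ι → DyadicCube n}
    {f : EuclideanSpace ℝ (Fin n) → ℝ}
    (hdisj : ∀ i j, i ≠ j → Disjoint (interior (S i).carrier) (interior (S j).carrier))
    (hW : ∀ i, ∃ x ∈ (S i).carrier, ∃ y ∉ DyadicCube.unionInterior S,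
      dist x y ≤ 4 * √(n : ℝ) * (S i).side)
    (hf : ∀ i, ContinuousOn f (S i).carrier) :
    ContinuousOn f (DyadicCube.unionInterior S) := by
  intro x hx
  obtain ⟨ε, hε, hball⟩ := Metric.isOpen_iff.1
    (isOpen_interior : IsOpen (DyadicCube.unionInterior S)) x hx
  set s := ε / (√(n : ℝ) + 1) with hs
  have hs0 : 0 < s := by positivity
  set b : EuclideanSpace ℝ (Fin n) := WithLp.toLp 2 fun k => x k - s with hb
  have hmem : ∀ y, y ∈ cube b (2 * s) → ∀ k, |y k - x k| ≤ s := by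
    intro y hy k
    have := hy k
    simp only [hb] at this
    rw [abs_le]; constructor <;> linarith
  have hQ : cube b (2 * s) ⊆ DyadicCube.unionInterior S := by
    intro y hy
    refine hball (Metric.mem_ball.2 ((dist_le_sqrt_mul hs0.le (hmem y hy)).trans_lt ?_))
    rw [hs, ← mul_div_assoc, div_lt_iff₀ (by positivity)]
    nlinarith
  have hnhds : cube b (2 * s) ∈ 𝓝 x := by
    rw [mem_nhds_iff]
    refine ⟨interior (cube b (2 * s)), interior_subset, isOpen_interior, ?_⟩
    rw [interior_cube]
    intro k
    simp only [hb]
    constructor <;> linarith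
  exact ((continuousOn_cube_of_glued hdisj hW hf (by positivity) hQ).continuousAt
    hnhds).continuousWithinAt

/-- If a point `p` of the segment from `x` to the centre of a cube is close to the complement of
the cube, then `p` is close to `x`. -/
theorem abs_sub_le_of_mem_segment_center {b x z p y : EuclideanSpace ℝ (Fin n)} {r D : ℝ}
    (hx : x ∈ cube b r) (hz : ∀ k, z k = b k + r / 2) (hp : p ∈ segment ℝ x z)
    (hy : y ∉ cube b r) (hpy : ∀ k, |p k - y k| ≤ D) (k : Fin n) : |x k - p k| ≤ D := by
  obtain ⟨s, t, hs, ht, hst, rfl⟩ := hp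
  have hs' : s = 1 - t := by linarith
  subst hs'
  simp only [PiLp.add_apply, PiLp.smul_apply, smul_eq_mul, hz] at hpy ⊢
  -- The point p has coordinate distance at least t r/2 from every face, while y lies beyond some
  -- face; and x - p is t times x - z.
  have htD : t * (r / 2) ≤ D := by
    simp only [cube, mem_ofPred_eq, not_forall, not_and_or, not_le] at hy
    obtain ⟨j, hj⟩ := hy
    have h1 := abs_le.1 (hpy j)
    have h2 := hx j
    rcases hj with hj | hj
    · nlinarith [mul_nonneg hs (sub_nonneg.2 h2.1)]
    · nlinarith [mul_nonneg hs (sub_nonneg.2 h2.2)]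
  have h2 := hx k
  refine le_trans ?_ htD
  have : x k - ((1 - t) * x k + t * (b k + r / 2)) = t * (x k - (b k + r / 2)) := by ring
  rw [this, abs_mul, abs_of_nonneg ht]
  refine mul_le_mul_of_nonneg_left ?_ ht
  rw [abs_le]; constructor <;> linarith

end Whitney

/-! ### Mean oscillation of a glued function -/

section Oscillation

variable {n : ℕ} {ι : Type*}

theorem lintegral_frontier_layers_le [NeZero n] (a b : EuclideanSpace ℝ (Fin n)) (ℓ r : ℝ) :
    ∫⁻ x in cube a ℓ ∩ cube b r, (1 + ∑' m : ℕ,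
      if Metric.infDist x (frontier (cube a ℓ)) < min ℓ r / 2 ^ m then 1 else 0) ≤
      (1 + 4 * n) * ENNReal.ofReal (min ℓ r) ^ n := by
  have hmeas : ∀ m : ℕ, MeasurableSet
      {x | Metric.infDist x (frontier (cube a ℓ)) < min ℓ r / 2 ^ m} := fun m =>
    (isOpen_lt (Metric.continuous_infDist_pt _) continuous_const).measurableSet
  have hind : ∀ (m : ℕ) (x : EuclideanSpace ℝ (Fin n)),
      (if Metric.infDist x (frontier (cube a ℓ)) < min ℓ r / 2 ^ m then (1 : ℝ≥0∞) else 0) =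
      {x | Metric.infDist x (frontier (cube a ℓ)) < min ℓ r / 2 ^ m}.indicator 1 x := by
    intro m x
    simp [indicator]
  simp only [hind]
  rw [lintegral_add_left measurable_const, lintegral_tsum fun m =>
    (measurable_one.indicator (hmeas m)).aemeasurable]
  simp only [lintegral_indicator_one (hmeas _), Measure.restrict_apply (hmeas _), lintegral_const,
    one_mul, Measure.restrict_apply_univ]
  have hlayer : ∀ m : ℕ, volume ({x | Metric.infDist x (frontier (cube a ℓ)) < min ℓ r / 2 ^ m} ∩
      (cube a ℓ ∩ cube b r)) ≤ 2 * n * ENNReal.ofReal (min ℓ r) ^ n * (2⁻¹ : ℝ≥0∞) ^ m := by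
    intro m
    rw [inter_comm]
    refine (volume_near_frontier_le (a := a) (b := b) (ℓ := ℓ) (r := r)).trans (le_of_eq ?_)
    rw [div_eq_mul_inv, ENNReal.ofReal_mul' (by positivity), ENNReal.ofReal_inv_of_pos (by positivity),
      ENNReal.ofReal_pow (by norm_num), ENNReal.ofReal_ofNat, ENNReal.inv_pow]
    obtain ⟨k, rfl⟩ : ∃ k, n = k + 1 := ⟨n - 1, (Nat.succ_pred (NeZero.ne n)).symm⟩
    rw [Nat.add_sub_cancel, pow_succ (ENNReal.ofReal (min ℓ r)) k]
    ring
  refine (add_le_add volume_cube_inter_cube_le (ENNReal.tsum_le_tsum hlayer)).trans (le_of_eq ?_)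
  rw [ENNReal.tsum_mul_left, ENNReal.tsum_geometric, ENNReal.one_sub_inv_two, inv_inv]
  ring

/-- The mean oscillation of a glued function: `V i` is the reference height on the `i`-th cube,
the deviation from it is controlled by the distance to the boundary of that cube, and the
reference heights of adjacent cubes differ by at most `e₂`. -/
theorem meanOsc_le_of_glued [NeZero n] [Countable ι] {S : ι → DyadicCube n}
    (hdisj : ∀ i j, i ≠ j → Disjoint (interior (S i).carrier) (interior (S j).carrier))
    (hW : ∀ i, ∃ x ∈ (S i).carrier, ∃ y ∉ DyadicCube.unionInterior S,
      dist x y ≤ 4 * √(n : ℝ) * (S i).side)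
    {f : EuclideanSpace ℝ (Fin n) → ℝ} {V : ι → ℝ} {e₁ e₂ r : ℝ} {b : EuclideanSpace ℝ (Fin n)}
    (hr : 0 < r) (hQ : cube b r ⊆ DyadicCube.unionInterior S) (hf : ContinuousOn f (cube b r))
    (he₁ : 0 ≤ e₁) (he₂ : 0 ≤ e₂)
    (hdev : ∀ i, ∀ x ∈ (S i).carrier ∩ cube b r, ENNReal.ofReal |f x - V i| ≤
      ENNReal.ofReal e₁ * (1 + ∑' m : ℕ,
        if Metric.infDist x (frontier (S i).carrier) < min (S i).side r / 2 ^ m then 1 else 0))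
    (hjump : ∀ i j, DyadicCube.Adjacent S i j → ((S i).carrier ∩ cube b r).Nonempty →
      ((S j).carrier ∩ cube b r).Nonempty → |V i - V j| ≤ e₂) :
    meanOsc f (cube b r) ≤
      2 * (((1 + 4 * n) * e₁ + (4 + 8 * √(n : ℝ)) ^ n * e₂) * 3 ^ n) := by
  have hfin := finite_meets_cube hdisj hW hr hQ
  let J := {i // ((S i).carrier ∩ cube b r).Nonempty}
  let z : EuclideanSpace ℝ (Fin n) := WithLp.toLp 2 fun k => b k + r / 2
  have hz : ∀ k, z k = b k + r / 2 := fun k => rfl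
  have hzQ : z ∈ cube b r := fun k => by rw [hz]; constructor <;> linarith
  obtain ⟨i₀, hi₀⟩ := exists_mem_carrier (hQ hzQ)
  choose p hp using fun i : J => i.2
  let ρ : J → ℝ := fun j => min (S j).side r
  -- Here 1 + 4√n bounds the distance from x to the meeting point q, and the further 1 the distance
  -- from q to `p j`, in units of `ρ j`.
  let A : ℝ := 2 + 4 * √(n : ℝ)
  have hA : 0 ≤ A := by positivity
  let U : J → Set (EuclideanSpace ℝ (Fin n)) := fun j =>
    closedBox (fun k => p j k - A * ρ j) (fun k => p j k + A * ρ j)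
  let g : J → EuclideanSpace ℝ (Fin n) → ℝ≥0∞ := fun j x => 1 + ∑' m : ℕ,
    if Metric.infDist x (frontier (S j).carrier) < min (S j).side r / 2 ^ m then 1 else 0
  have hUvol : ∀ j, volume (U j) = ENNReal.ofReal (4 + 8 * √(n : ℝ)) ^ n *
      ENNReal.ofReal (ρ j) ^ n := by
    intro j
    rw [volume_closedBox, ← mul_pow, ← ENNReal.ofReal_mul (by positivity)]
    rw [Finset.prod_congr rfl (g := fun _ => ENNReal.ofReal ((4 + 8 * √(n : ℝ)) * ρ j))]
    · simp
    · intro k _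
      congr 1
      simp only [A]
      ring
  have hUmeas : ∀ j, MeasurableSet (U j) := fun j => by
    simp only [U, closedBox_eq_preimage]
    exact (PiLp.volume_preserving_ofLp (Fin n)).measurable measurableSet_Icc
  have hCmeas : ∀ j : J, MeasurableSet ((S j).carrier ∩ cube b r) := fun j =>
    (S j).isClosed_carrier.measurableSet.inter (isCompact_cube b r).measurableSet
  have hgmeas : ∀ j, Measurable (g j) := fun j => by
    have hlayer : ∀ m : ℕ, Measurable fun x : EuclideanSpace ℝ (Fin n) =>
        if Metric.infDist x (frontier (S j).carrier) < min (S j).side r / 2 ^ m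
          then (1 : ℝ≥0∞) else 0 := fun m =>
      Measurable.ite (isOpen_lt (Metric.continuous_infDist_pt _)
        continuous_const).measurableSet measurable_const measurable_const
    exact measurable_const.add (Measurable.tsum hlayer)
  have hFmeas : ∀ j : J, Measurable fun x =>
      ((S j).carrier ∩ cube b r).indicator (fun x => ENNReal.ofReal e₁ * g j x) x +
        (U j).indicator (fun _ => ENNReal.ofReal e₂) x := fun j =>
    (((hgmeas j).const_mul _).indicator (hCmeas j)).add
      (measurable_const.indicator (hUmeas j))
  have hshadow : ∀ x ∈ cube b r, ∀ j : J, (segment ℝ x z ∩ (S j).carrier).Nonempty → x ∈ U j := by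
    rintro x hx j ⟨q, hq, hqS⟩ k
    obtain ⟨y, hy, hqy⟩ := exists_notMem_unionInterior (hW j) hqS
    have hqQ : q ∈ cube b r := (convex_cube b r).segment_subset hx hzQ hq
    have h1 : |x k - q k| ≤ (1 + 4 * √(n : ℝ)) * (S j).side :=
      abs_sub_le_of_mem_segment_center hx hz hq (fun h => hy (hQ h)) hqy k
    have h2 : |x k - q k| ≤ (1 + 4 * √(n : ℝ)) * r :=
      (abs_sub_le_of_mem_cube hx hqQ k).trans
        (le_mul_of_one_le_left hr.le (by linarith [Real.sqrt_nonneg (n : ℝ)]))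
    have h3 : |x k - q k| ≤ (1 + 4 * √(n : ℝ)) * ρ j := by
      simp only [ρ]
      rw [mul_min_of_nonneg _ _ (by positivity)]
      exact le_min h1 h2
    have h4 : |q k - p j k| ≤ ρ j :=
      le_min (abs_sub_le_of_mem_cube hqS (hp j).1 k) (abs_sub_le_of_mem_cube hqQ (hp j).2 k)
    have h5 := abs_sub_le (x k) (q k) (p j k)
    have h6 : |x k - p j k| ≤ A * ρ j := by simp only [A]; linarith
    have := abs_le.1 h6
    constructor <;> linarith
  have hpt : ∀ x ∈ cube b r, ENNReal.ofReal |f x - V i₀| ≤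
      ∑' j : J, (((S j).carrier ∩ cube b r).indicator (fun x => ENNReal.ofReal e₁ * g j x) x +
        (U j).indicator (fun _ => ENNReal.ofReal e₂) x) := by
    intro x hx
    obtain ⟨i, hi⟩ := exists_mem_carrier (hQ hx)
    have hseg : segment ℝ x z ⊆ cube b r := (convex_cube b r).segment_subset hx hzQ
    have hchain := ofReal_abs_sub_le_tsum_of_isPreconnected (ι := J)
      (T := fun j => (S j).carrier) (K := segment ℝ x z) (V := fun j => V j) (e := e₂)
      (fun j => (S j).isClosed_carrier) (convex_segment x z).isPreconnected
      (fun q hq => by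
        obtain ⟨j, hj⟩ := exists_mem_carrier (hQ (hseg hq))
        exact mem_iUnion.2 ⟨⟨j, q, hj, hseg hq⟩, hj⟩) he₂
      (fun j k hjk hne => hjump j k ⟨Subtype.coe_injective.ne hjk, hne⟩ j.2 k.2)
      (i₀ := ⟨i₀, z, hi₀, hzQ⟩) (i₁ := ⟨i, x, hi, hx⟩)
      ⟨z, right_mem_segment ℝ x z, hi₀⟩ ⟨x, left_mem_segment ℝ x z, hi⟩
    rw [ENNReal.tsum_add]
    calc ENNReal.ofReal |f x - V i₀|
        ≤ ENNReal.ofReal |f x - V i| + ENNReal.ofReal |V i - V i₀| := by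
          rw [← ENNReal.ofReal_add (abs_nonneg _) (abs_nonneg _)]
          exact ENNReal.ofReal_le_ofReal (abs_sub_le _ _ _)
      _ ≤ _ := by
          refine add_le_add ?_ (hchain.trans (ENNReal.tsum_le_tsum fun j => ?_))
          · refine le_trans ?_ (ENNReal.le_tsum (⟨i, x, hi, hx⟩ : J))
            rw [indicator_of_mem (show x ∈ (S i).carrier ∩ cube b r from ⟨hi, hx⟩)]
            exact hdev i x ⟨hi, hx⟩
          · by_cases hj : (segment ℝ x z ∩ (S j).carrier).Nonempty
            · rw [indicator_of_mem (hshadow x hx j hj)]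
              exact indicator_le_self _ _ _
            · rw [indicator_of_notMem (show j ∉ {j : J | (segment ℝ x z ∩ (S j).carrier).Nonempty} from hj)]
              exact zero_le
  refine meanOsc_le (c := V i₀) hr (by positivity) hf ?_
  calc ∫⁻ x in cube b r, ENNReal.ofReal |f x - V i₀|
      ≤ ∫⁻ x in cube b r,
        ∑' j : J, (((S j).carrier ∩ cube b r).indicator (fun x => ENNReal.ofReal e₁ * g j x) x +
        (U j).indicator (fun _ => ENNReal.ofReal e₂) x) :=
        setLIntegral_mono' (isCompact_cube b r).measurableSet hpt
    _ ≤ ∫⁻ x, ∑' j : J, (((S j).carrier ∩ cube b r).indicator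
          (fun x => ENNReal.ofReal e₁ * g j x) x +
        (U j).indicator (fun _ => ENNReal.ofReal e₂) x) := setLIntegral_le_lintegral _ _
    _ = ∑' j : J, (ENNReal.ofReal e₁ * ∫⁻ x in (S j).carrier ∩ cube b r, g j x) +
        ∑' j : J, ENNReal.ofReal e₂ * volume (U j) := by
        rw [lintegral_tsum fun j => (hFmeas j).aemeasurable, ← ENNReal.tsum_add]
        refine tsum_congr fun j => ?_
        rw [lintegral_add_left (((hgmeas j).const_mul _).indicator (hCmeas j)),
          lintegral_indicator (hCmeas j), lintegral_indicator (hUmeas j),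
          lintegral_const_mul _ (hgmeas j), setLIntegral_const]
    _ ≤ ∑' j : J, (ENNReal.ofReal e₁ * ((1 + 4 * n) * ENNReal.ofReal (ρ j) ^ n)) +
        ∑' j : J, ENNReal.ofReal e₂ * (ENNReal.ofReal (4 + 8 * √(n : ℝ)) ^ n *
          ENNReal.ofReal (ρ j) ^ n) := by
        refine add_le_add (ENNReal.tsum_le_tsum fun j => ?_)
          (ENNReal.tsum_le_tsum fun j => by rw [hUvol])
        exact mul_le_mul_right (lintegral_frontier_layers_le _ _ _ _) _
    _ = (ENNReal.ofReal e₁ * (1 + 4 * n) + ENNReal.ofReal e₂ *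
          ENNReal.ofReal (4 + 8 * √(n : ℝ)) ^ n) * ∑' j : J, ENNReal.ofReal (ρ j) ^ n := by
        simp only [← mul_assoc]
        rw [ENNReal.tsum_mul_left, ENNReal.tsum_mul_left, add_mul]
    _ ≤ (ENNReal.ofReal e₁ * (1 + 4 * n) + ENNReal.ofReal e₂ *
          ENNReal.ofReal (4 + 8 * √(n : ℝ)) ^ n) * ENNReal.ofReal (3 * r) ^ n :=
        mul_le_mul_right (tsum_min_side_pow_le hdisj b r) _
    _ = _ := by
        rw [← ENNReal.ofReal_pow (by positivity), ← ENNReal.ofReal_pow (by positivity),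
          ← ENNReal.ofReal_pow hr.le, ← ENNReal.ofReal_mul he₂]
        have : (1 + 4 * (n : ℝ≥0∞)) = ENNReal.ofReal (1 + 4 * n) := by
          rw [ENNReal.ofReal_add (by norm_num) (by positivity), ENNReal.ofReal_mul (by norm_num)]
          simp
        rw [this, ← ENNReal.ofReal_mul he₁, ← ENNReal.ofReal_add (by positivity) (by positivity),
          ← ENNReal.ofReal_mul (by positivity), ← ENNReal.ofReal_mul (by positivity)]
        congr 1
        ring

end Oscillation

/-! ### Glued bumps at a fixed scale -/

section GluedBumps

theorem IsModulus.le_modulusSup {η : ℝ → ℝ} (h : IsModulus η) {t : ℝ} (ht : 0 ≤ t) :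
    η t ≤ modulusSup η := le_csSup h.bdd ⟨t, ht, rfl⟩

theorem IsModulus.modulusSup_nonneg {η : ℝ → ℝ} (h : IsModulus η) : 0 ≤ modulusSup η :=
  (h.nonneg 0 le_rfl).trans (h.le_modulusSup le_rfl)

theorem IsModulus.exists_le {η : ℝ → ℝ} (h : IsModulus η) {ε : ℝ} (hε : 0 < ε) :
    ∃ s > 0, ∀ t, 0 ≤ t → t ≤ s → η t ≤ ε := by
  have h1 : ∀ᶠ t in 𝓝[≥] (0 : ℝ), η t < ε := h.cont.eventually (gt_mem_nhds (by rwa [h.zero]))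
  obtain ⟨s, hs, hsub⟩ := (mem_nhdsGE_iff_exists_Icc_subset).1 h1
  exact ⟨s, hs, fun t h0 hts => (hsub ⟨h0, hts⟩ : η t < ε).le⟩

variable {n : ℕ} {ι : Type*}

/-- The mean oscillation of a function glued from bumps over a cube `Q` is controlled by bounds
for the relative heights and for the jumps between adjacent cubes, where the bounds are needed
only for those cubes meeting `Q` for which the bump does not vanish near the boundary at the
scale of `Q`. -/
theorem meanOsc_le_of_glued_bumps [NeZero n] [Countable ι] {S : ι → DyadicCube n}
    (hdisj : ∀ i j, i ≠ j → Disjoint (interior (S i).carrier) (interior (S j).carrier))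
    (hadj : ∀ i j, DyadicCube.Adjacent S i j →
      (S i).side / 4 ≤ (S j).side ∧ (S j).side ≤ 4 * (S i).side)
    (hW : ∀ i, ∃ x ∈ (S i).carrier, ∃ y ∉ DyadicCube.unionInterior S,
      dist x y ≤ 4 * √(n : ℝ) * (S i).side)
    {lam μ : ι → ℝ} {C : ℝ} (hμ : ∀ i, 1 ≤ μ i)
    (hμadj : ∀ i j, DyadicCube.Adjacent S i j → |μ i - μ j| ≤ C)
    {f : EuclideanSpace ℝ (Fin n) → ℝ}
    (hf : ∀ i, ∀ x ∈ (S i).carrier, f x = lam i * (S i).bump (μ i) x)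
    {e₁ e₂ r : ℝ} {b : EuclideanSpace ℝ (Fin n)} (hC : 0 ≤ C)
    (hr : 0 < r) (hQ : cube b r ⊆ DyadicCube.unionInterior S) (he₁ : 0 ≤ e₁) (he₂ : 0 ≤ e₂)
    (hlam : ∀ i, |lam i| / μ i ≤ e₁ ∨
      2 * r ≤ (S i).side / 4 * 2 ^ (-μ i) ∧
        |lam i| / μ i * (r / ((S i).side / 4 * 2 ^ (-μ i)) / Real.log 2) ≤ e₁)
    (hlamadj : ∀ i j, DyadicCube.Adjacent S i j →
      (|lam i| / μ i ≤ e₁ ∧ |lam i - lam j| ≤ e₂) ∨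
      2 * r ≤ (S i).side / 4 * 2 ^ (-μ i) ∧ 2 * r ≤ (S j).side / 4 * 2 ^ (-μ j)) :
    meanOsc f (cube b r) ≤ 2 * (((1 + 4 * n) * e₁ + (4 + 8 * √(n : ℝ)) ^ n *
      (2 * e₂ + (2 + 2 * C) * e₁)) * 3 ^ n) := by
  have hμ0 : ∀ i, 0 < μ i := fun i => one_pos.trans_le (hμ i)
  have hfd : ∀ i, ∀ x ∈ (S i).carrier, f x = lam i * bumpProfile (S i).side (μ i)
      (Metric.infDist x (frontier (S i).carrier)) := fun i x hx => by
    rw [hf i x hx, (S i).bump_eq (hμ0 i)]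
  have hcont : ContinuousOn f (cube b r) :=
    continuousOn_cube_of_glued hdisj hW (fun i => ContinuousOn.congr
      (continuous_const.mul ((S i).continuous_bump (hμ0 i))).continuousOn (hf i)) hr hQ
  -- A point deeper than 2r puts all of Q inside one cube at depth above r, where depths differ by a
  -- factor of at most 2. Otherwise every depth is at most 2r, and a bump vanishing up to depth 2r
  -- is zero on Q with reference height zero.
  by_cases hdeep : ∃ i, ∃ x ∈ (S i).carrier ∩ cube b r,
      2 * r < Metric.infDist x (frontier (S i).carrier)
  · obtain ⟨i, x₀, ⟨hx₀, hx₀Q⟩, hdx₀⟩ := hdeep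
    have hsub : cube b r ⊆ (S i).carrier := fun x hx =>
      mem_cube_of_infDist_frontier hx₀
        (by linarith : r ≤ Metric.infDist x₀ (frontier (S i).carrier))
        fun k => abs_sub_le_of_mem_cube hx₀Q hx k
    have hosc : meanOsc f (cube b r) ≤ 2 * e₁ := by
      refine meanOsc_le_of_abs_sub_le hr he₁ hcont fun x hx y hy => ?_
      have hlip : ∀ x ∈ cube b r, ∀ y ∈ cube b r,
          Metric.infDist x (frontier (S i).carrier) ≤
          Metric.infDist y (frontier (S i).carrier) + r := fun x hx y hy =>
        infDist_frontier_cube_le_add (hsub hx) (hsub hy) fun k => abs_sub_le_of_mem_cube hx hy k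
      have hxy := hlip x hx y hy
      have hyx := hlip y hy x hx
      rw [hfd i x (hsub hx), hfd i y (hsub hy), ← mul_sub, abs_mul]
      rcases hlam i with h | ⟨-, h⟩
      · have h1 := hlip _ hx₀Q x hx
        have h2 := hlip _ hx₀Q y hy
        have := abs_bumpProfile_sub_le (S i).side_pos (hμ0 i) one_le_two
          (by linarith : Metric.infDist x (frontier (S i).carrier) ≤
            2 * Metric.infDist y (frontier (S i).carrier)) (by linarith)
        rw [Real.logb_self_eq_one (by norm_num), mul_one] at this
        refine (mul_le_mul_of_nonneg_left this (abs_nonneg _)).trans ?_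
        rwa [mul_one_div]
      · have := abs_bumpProfile_sub_le_of_abs_sub_le (S i).side_pos (hμ0 i)
          (abs_le.2 ⟨by linarith, by linarith⟩ :
            |Metric.infDist x (frontier (S i).carrier) -
              Metric.infDist y (frontier (S i).carrier)| ≤ r)
        refine (mul_le_mul_of_nonneg_left this (abs_nonneg _)).trans ?_
        rwa [← mul_assoc, mul_one_div]
    refine hosc.trans (mul_le_mul_of_nonneg_left ?_ (by norm_num))
    have h1 : e₁ ≤ (1 + 4 * n) * e₁ := le_mul_of_one_le_left he₁ (by linarith [Nat.cast_nonneg (α := ℝ) n])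
    have h2 : 0 ≤ (4 + 8 * √(n : ℝ)) ^ n * (2 * e₂ + (2 + 2 * C) * e₁) := by positivity
    exact (h1.trans (le_add_of_nonneg_right h2)).trans
      (le_mul_of_one_le_right (by positivity) (one_le_pow₀ (by norm_num)))
  · push Not at hdeep
    refine meanOsc_le_of_glued hdisj hW (V := fun i => lam i * bumpProfile (S i).side (μ i) r)
      hr hQ hcont he₁ (by positivity) (fun i x hx => ?_) (fun i j hij _ _ => ?_)
    · have hd := hdeep i x hx
      rw [hfd i x hx.1, ← mul_sub, abs_mul]
      rcases hlam i with h | ⟨h, -⟩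
      · have hd' : Metric.infDist x (frontier (S i).carrier) ≤ 2 * min (S i).side r := by
          rw [mul_min_of_nonneg _ _ (by norm_num)]
          refine le_min ?_ hd
          have := infDist_frontier_cube_le hx.1
          have := (S i).side_pos
          simp only [DyadicCube.carrier]
          linarith
        rw [ENNReal.ofReal_mul (abs_nonneg _)]
        refine (mul_le_mul_right (ofReal_abs_bumpProfile_sub_le (S i).side_pos (hμ0 i) hr
          Metric.infDist_nonneg hd') _).trans ?_
        rw [← mul_assoc, ← ENNReal.ofReal_mul (abs_nonneg _), mul_one_div]
        exact mul_le_mul_left (ENNReal.ofReal_le_ofReal h) _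
      · rw [bumpProfile_eq_zero (S i).side_pos (hμ0 i) (hd.trans h),
          bumpProfile_eq_zero (S i).side_pos (hμ0 i) (by linarith)]
        simp
    · rcases hlamadj i j hij with ⟨h1, h2⟩ | ⟨h1, h2⟩
      · obtain ⟨h3, h4⟩ := hadj i j hij
        refine (abs_mul_bumpProfile_sub_le (S i).side_pos (S j).side_pos (hμ0 i) (hμ0 j) hr.le
          (by linarith) h4 (hμadj i j hij)).trans ?_
        rw [mul_comm (2 + 2 * C)]
        gcongr
      · rw [bumpProfile_eq_zero (S i).side_pos (hμ0 i) (by linarith),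
          bumpProfile_eq_zero (S j).side_pos (hμ0 j) (by linarith)]
        simp only [mul_zero, sub_zero, abs_zero]
        positivity

theorem memVMO_empty_and_bmoNorm_empty_le (f : EuclideanSpace ℝ (Fin n) → ℝ) (K : ℝ) :
    MemVMO ∅ f ∧ bmoNorm ∅ f ≤ ENNReal.ofReal K := by
  have hne : ∀ (b : EuclideanSpace ℝ (Fin n)) (r : ℝ), 0 < r → ¬ cube b r ⊆ ∅ := fun b r hr h =>
    h (show b ∈ cube b r from fun k => ⟨le_rfl, by linarith⟩)
  have hbmo : bmoNorm ∅ f = 0 := by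
    simp only [bmoNorm, ENNReal.iSup_eq_zero]
    exact fun b r hr h => absurd h (hne b r hr)
  have hosc : oscModulus ∅ f = fun _ => 0 := by
    funext t
    simp only [oscModulus, ENNReal.iSup_eq_zero]
    exact fun b r hr _ h => absurd h (hne b r hr)
  refine ⟨⟨⟨fun x hx => absurd hx (notMem_empty x), ?_⟩, ?_⟩, ?_⟩
  · simp [hbmo]
  · rw [hosc]
    exact tendsto_const_nhds
  · simp [hbmo]

end GluedBumps

/-! ### The BMO bound and vanishing oscillation -/

theorem proposition1 (n : ℕ) (C₁ C₂ C₃ : ℝ) (hC₁ : 0 < C₁) (hC₃ : 0 < C₃) :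
    ∃ K : ℝ, 0 < K ∧
      ∀ (ι : Type*) [Countable ι] (S : ι → DyadicCube n) (lam μ : ι → ℝ) (δ₁ δ₂ : ℝ → ℝ)
        (Ψ : EuclideanSpace ℝ (Fin n) → ℝ),
        -- the cubes have pairwise disjoint interiors
        (∀ i j, i ≠ j → Disjoint (interior (S i).carrier) (interior (S j).carrier)) →
        -- adjacent cubes have comparable sidelengths
        (∀ i j, DyadicCube.Adjacent S i j →
          (S i).side / 4 ≤ (S j).side ∧ (S j).side ≤ 4 * (S i).side) →
        -- the cubes are of Whitney type: the distance from each of them to the complement of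
        -- the interior of their union is at most `4 √n` sidelengths
        (∀ i, ∃ x ∈ (S i).carrier, ∃ y ∉ DyadicCube.unionInterior S,
          dist x y ≤ 4 * √(n : ℝ) * (S i).side) →
        -- the supremum of the sidelengths is finite
        BddAbove (range fun i => (S i).side) →
        (∀ i, 1 ≤ μ i) →
        (∀ i, C₁ * Real.logb 2 ((⨆ j, (S j).side) / (S i).side) - C₂ ≤ μ i) →
        (∀ i j, DyadicCube.Adjacent S i j → |μ i - μ j| ≤ C₃) →
        IsModulus δ₁ → IsModulus δ₂ →
        (∀ i, |lam i| / μ i ≤ δ₁ (1 / μ i)) →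
        (∀ i j, DyadicCube.Adjacent S i j → |lam i - lam j| ≤ δ₂ (1 / μ i + 1 / μ j)) →
        -- `Ψ` is the glued function
        (∀ i, ∀ x ∈ (S i).carrier, Ψ x = lam i * (S i).bump (μ i) x) →
        MemVMO (DyadicCube.unionInterior S) Ψ ∧
          bmoNorm (DyadicCube.unionInterior S) Ψ ≤
            ENNReal.ofReal (K * (modulusSup δ₁ + modulusSup δ₂)) := by
  let P : ℝ → ℝ → ℝ := fun e₁ e₂ => 2 * (((1 + 4 * n) * e₁ + (4 + 8 * √(n : ℝ)) ^ n *
    (2 * e₂ + (2 + 2 * C₃) * e₁)) * 3 ^ n)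
  have hP : ∀ e, P e e = P 1 1 * e := fun e => by simp only [P]; ring
  have hPpos : 0 < P 1 1 := by simp only [P]; positivity
  refine ⟨P 1 1, hPpos, ?_⟩
  intro ι _ S lam μ δ₁ δ₂ Ψ hdisj hadj hW hbdd hμ hμside hμadj hδ₁ hδ₂ hlam hlamadj hΨ
  have hμ0 : ∀ i, 0 < μ i := fun i => one_pos.trans_le (hμ i)
  rcases (DyadicCube.unionInterior S).eq_empty_or_nonempty with hO | ⟨x₀, hx₀⟩
  · rw [hO]
    exact memVMO_empty_and_bmoNorm_empty_le Ψ _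
  obtain ⟨i₀, -⟩ := exists_mem_carrier hx₀
  -- In dimension zero a nonempty open set is the whole space, which leaves no complement for the
  -- Whitney condition.
  have : NeZero n := by
    refine ⟨?_⟩
    rintro rfl
    obtain ⟨_, _, y, hy, _⟩ := hW i₀
    exact hy (Subsingleton.elim x₀ y ▸ hx₀)
  have hM₁ := hδ₁.modulusSup_nonneg
  have hM₂ := hδ₂.modulusSup_nonneg
  have hlamM : ∀ i, |lam i| / μ i ≤ modulusSup δ₁ := fun i =>
    (hlam i).trans (hδ₁.le_modulusSup (one_div_nonneg.2 (hμ0 i).le))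
  have hbmo : bmoNorm (DyadicCube.unionInterior S) Ψ ≤
      ENNReal.ofReal (P 1 1 * (modulusSup δ₁ + modulusSup δ₂)) := by
    refine iSup_le fun b => iSup_le fun r => iSup_le fun hr => iSup_le fun hQ =>
      ENNReal.ofReal_le_ofReal ?_
    rw [← hP]
    refine meanOsc_le_of_glued_bumps hdisj hadj hW hμ hμadj hΨ hC₃.le hr hQ (by positivity)
      (by positivity) (fun i => Or.inl ?_) (fun i j hij => Or.inl ⟨?_, ?_⟩)
    · linarith [hlamM i]
    · linarith [hlamM i]
    · have := hδ₂.le_modulusSup (add_nonneg (one_div_nonneg.2 (hμ0 i).le)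
        (one_div_nonneg.2 (hμ0 j).le))
      linarith [hlamadj i j hij]
  refine ⟨⟨⟨?_, hbmo.trans_lt ENNReal.ofReal_lt_top⟩, ?_⟩, hbmo⟩
  · exact (continuousOn_unionInterior_of_glued hdisj hW fun i => ContinuousOn.congr
      (continuous_const.mul ((S i).continuous_bump (hμ0 i))).continuousOn
        (hΨ i)).locallyIntegrableOn isOpen_interior.measurableSet
  rw [ENNReal.tendsto_nhds_zero]
  intro ε hε
  obtain ⟨ε', hε'0, hε'⟩ : ∃ ε' : ℝ, 0 < ε' ∧ ENNReal.ofReal (P 1 1 * ε') ≤ ε := by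
    rcases eq_or_ne ε ∞ with rfl | htop
    · exact ⟨1, one_pos, le_top⟩
    · refine ⟨ε.toReal / P 1 1, div_pos (ENNReal.toReal_pos hε.ne' htop) hPpos, ?_⟩
      rw [mul_div_cancel₀ _ hPpos.ne', ENNReal.ofReal_toReal htop]
  obtain ⟨s₁, hs₁, hδ₁s⟩ := hδ₁.exists_le hε'0
  obtain ⟨s₂, hs₂, hδ₂s⟩ := hδ₂.exists_le hε'0
  -- exponents above `M` are harmless; for the others the sidelengths are bounded below
  obtain ⟨M, hM0, hM₁s, hM₂s⟩ : ∃ M : ℝ, 0 < M ∧ 1 / M ≤ s₁ ∧ 2 / M ≤ s₂ := by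
    refine ⟨1 / s₁ + 2 / s₂, by positivity, ?_, ?_⟩
    · rw [div_le_iff₀ (by positivity)]
      have : s₁ * (1 / s₁ + 2 / s₂) = 1 + s₁ * (2 / s₂) := by field_simp
      rw [this]
      have : 0 ≤ s₁ * (2 / s₂) := by positivity
      linarith
    · rw [div_le_iff₀ (by positivity)]
      have : s₂ * (1 / s₁ + 2 / s₂) = 2 + s₂ * (1 / s₁) := by field_simp; ring
      rw [this]
      have : 0 ≤ s₂ * (1 / s₁) := by positivity
      linarith
  set L := ⨆ j, (S j).side with hL
  have hLpos : 0 < L := (S i₀).side_pos.trans_le (le_ciSup hbdd i₀)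
  -- A lower bound for the width of the strip where the bump vanishes, for exponents up to M + C₃:
  -- the growth condition on μ bounds the sidelength below.
  set a := L * 2 ^ (-((M + C₃ + C₂) / C₁)) / 4 * 2 ^ (-(M + C₃)) with ha
  have ha0 : 0 < a := by positivity
  have hlow : ∀ i, μ i ≤ M + C₃ → a ≤ (S i).side / 4 * 2 ^ (-μ i) := by
    intro i hi
    have hside : L * 2 ^ (-((M + C₃ + C₂) / C₁)) ≤ (S i).side := by
      have h1 : Real.logb 2 (L / (S i).side) ≤ (M + C₃ + C₂) / C₁ := by
        rw [le_div_iff₀ hC₁]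
        linarith [hμside i]
      rw [Real.logb_le_iff_le_rpow (by norm_num) (div_pos hLpos (S i).side_pos),
        div_le_iff₀ (S i).side_pos] at h1
      rw [Real.rpow_neg (by norm_num), ← div_eq_mul_inv, div_le_iff₀ (by positivity)]
      linarith
    exact mul_le_mul (div_le_div_of_nonneg_right hside (by norm_num))
      (Real.rpow_le_rpow_of_exponent_le (by norm_num) (by linarith)) (by positivity)
      (div_nonneg (S i).side_pos.le (by norm_num))
  have hlog2 : 0 < Real.log 2 := Real.log_pos (by norm_num)
  obtain ⟨t₀, ht₀, ht₀a, ht₀ε⟩ : ∃ t₀ : ℝ, 0 < t₀ ∧ 2 * t₀ ≤ a ∧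
      modulusSup δ₁ * (t₀ / a / Real.log 2) ≤ ε' := by
    have hB : 0 < modulusSup δ₁ + 1 := by positivity
    refine ⟨min (a / 2) (ε' * a * Real.log 2 / (modulusSup δ₁ + 1)), by positivity, ?_, ?_⟩
    · linarith [min_le_left (a / 2) (ε' * a * Real.log 2 / (modulusSup δ₁ + 1))]
    · have h1 := min_le_right (a / 2) (ε' * a * Real.log 2 / (modulusSup δ₁ + 1))
      calc modulusSup δ₁ * (min (a / 2) (ε' * a * Real.log 2 / (modulusSup δ₁ + 1)) / a /
            Real.log 2)
          ≤ (modulusSup δ₁ + 1) * (ε' * a * Real.log 2 / (modulusSup δ₁ + 1) / a /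
            Real.log 2) := by gcongr; linarith
        _ = ε' := by field_simp
  filter_upwards [Ioo_mem_nhdsGT ht₀] with t ht
  refine iSup_le fun b => iSup_le fun r => iSup_le fun hr => iSup_le fun hrt => iSup_le fun hQ =>
    (ENNReal.ofReal_le_ofReal ?_).trans hε'
  have hrt₀ : r ≤ t₀ := hrt.le.trans ht.2.le
  rw [← hP]
  have hbig : ∀ i, M ≤ μ i → |lam i| / μ i ≤ ε' := fun i hi =>
    (hlam i).trans (hδ₁s _ (one_div_nonneg.2 (hμ0 i).le)
      ((one_div_le_one_div_of_le hM0 hi).trans hM₁s))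
  refine meanOsc_le_of_glued_bumps hdisj hadj hW hμ hμadj hΨ hC₃.le hr hQ hε'0.le hε'0.le
    (fun i => ?_) (fun i j hij => ?_)
  · rcases le_total M (μ i) with h | h
    · exact Or.inl (hbig i h)
    · have h1 := hlow i (by linarith)
      refine Or.inr ⟨by linarith, le_trans ?_ ht₀ε⟩
      have h2 : r / ((S i).side / 4 * 2 ^ (-μ i)) ≤ t₀ / a :=
        div_le_div₀ ht₀.le hrt₀ ha0 h1
      have h3 : 0 ≤ r / ((S i).side / 4 * 2 ^ (-μ i)) :=
        div_nonneg hr.le (ha0.le.trans h1)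
      exact mul_le_mul (hlamM i) (div_le_div_of_nonneg_right h2 hlog2.le)
        (div_nonneg h3 hlog2.le) hM₁
  · have hij' := abs_le.1 (hμadj i j hij)
    -- If one exponent is below M, both are at most M + C₃, so both bumps vanish up to depth 2r and
    -- there is no jump.
    by_cases h : M ≤ μ i ∧ M ≤ μ j
    · refine Or.inl ⟨hbig i h.1, (hlamadj i j hij).trans (hδ₂s _ (add_nonneg
        (one_div_nonneg.2 (hμ0 i).le) (one_div_nonneg.2 (hμ0 j).le)) (le_trans ?_ hM₂s))⟩
      have h1 := one_div_le_one_div_of_le hM0 h.1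
      have h2 := one_div_le_one_div_of_le hM0 h.2
      have : 2 / M = 1 / M + 1 / M := by ring
      linarith
    · have hle : μ i ≤ M + C₃ ∧ μ j ≤ M + C₃ := by
        rw [not_and_or, not_le, not_le] at h
        rcases h with h | h <;> constructor <;> linarith
      have h1 := hlow i hle.1
      have h2 := hlow j hle.2
      exact Or.inr ⟨by linarith, by linarith⟩
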